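/- Let $n\ge 1$ and let $\mathfrak S_n$ be the set of permutations $\sigma=\sigma_1\sigma_2\cdots\sigma_n$ of $[n]=\{1,\dots,n\}$. For any word $w=w_1\cdots w_m$ of positive integers put $w_0=w_{m+1}=0$; the letter $w_i$ ($1\le i\le m$) is a *valley* if $w_{i-1}>w_i<w_{i+1}$ and a *double descent* if $w_{i-1}>w_i>w_{i+1}$. For $\sigma\in\mathfrak S_n$ let - $\operatorname{inv}\sigma$ be the number of pairs $1\le i<j\le n$ with $\sigma_i>\sigma_j$, $\operatorname{exc}\sigma$ the number of $i\in[n]$ with $\sigma_i>i$, and $\operatorname{des}\sigma$ the number of $1\le i<n$ with $\sigma_i>\sigma_{i+1}$; - $\operatorname{les}\sigma$ be the number of pairs $2\le i<j\le n$ with $\sigma_{i-1}>\sigma_j>\sigma_i$; - $\operatorname{res}\sigma$ be the number of pairs $1\le i<j\le n-1$ with $\sigma_{j+1}>\sigma_i>\sigma_j$. Let $\mathcal G_{n,k}$ be the set of $\sigma\in\mathfrak S_n$ with exactly $k$ valleys and no double descent. A permutation $\sigma\in\mathfrak S_n$ is an *André permutation* if for every $1\le k\le n$ the subword of $\sigma$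 consisting of the letters $1,\dots,k$, in the order in which they appear in $\sigma$, has no double descent (so, by the convention $w_{m+1}=0$, it ends with an ascent if $k\ge 2$). Let $\mathfrak D_{n,k}$ be the set of André permutations of $[n]$ with exactly $k$ descents. Put $$\gamma_{n,k}(p,q)=\sum_{\sigma\in\mathcal G_{n,k}}p^{\operatorname{res}\sigma}q^{\operatorname{les}\sigma},\qquad d_{n,k}(q)=\sum_{\sigma\in\mathfrak D_{n,k}}q^{2\operatorname{res}\sigma+\operatorname{les}\sigma}.$$ Then $\operatorname{exc}\sigma\le\operatorname{inv}\sigma$ for all $\sigma\in\mathfrak S_n$, and, as polynomials in $q$ and $t$ (equivalently, for all elements $q,t$ of any commutative ring), $$\sum_{\sigma\in\mathfrak S_n}q^{\operatorname{inv}\sigma-\operatorname{exc}\sigma}\,t^{\operatorname{exc}\sigma} =\sum_{k=0}^{\lfloor (n-1)/2\rfloor}\gamma_{n,k}(q^2,q)\,t^k(1+t)^{n-1-2k} =\sum_{k=0}^{\lfloor (n-1)/2\rfloor}(1+q)^k\,d_{n,k}(q)\,t^k(1+t)^{n-1-2k}.$$ -/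

import Mathlib

namespace AndrePerm

/-- The `i`-th letter `w_i` (for `1 ≤ i ≤ m`) of a word `w = w_1 … w_m`, with the
convention `w_0 = w_{m+1} = 0`. -/
def letter (w : List ℕ) (i : ℕ) : ℕ := (0 :: w).getD i 0

/-- The one-line notation `σ_1 … σ_n` of a permutation of `[n] = {1, …, n}`; the index set
`Fin n` stands for `[n]` through `i ↦ i + 1`. -/
def oneLine {n : ℕ} (σ : Equiv.Perm (Fin n)) : List ℕ := List.ofFn fun i => (σ i : ℕ) + 1

/-- Number of descent positions: `1 ≤ i < m` with `w_i > w_{i+1}`. -/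
def des (w : List ℕ) : ℕ :=
  ((Finset.Icc 1 w.length).filter fun i => i < w.length ∧ letter w (i + 1) < letter w i).card

/-- Number of excedance positions: `1 ≤ i ≤ m` with `w_i > i`. -/
def exc (w : List ℕ) : ℕ :=
  ((Finset.Icc 1 w.length).filter fun i => i < letter w i).card

/-- Number of inversions: pairs `1 ≤ i < j ≤ m` with `w_i > w_j`. -/
def inv (w : List ℕ) : ℕ :=
  ((Finset.Icc 1 w.length ×ˢ Finset.Icc 1 w.length).filter fun x =>
    x.1 < x.2 ∧ letter w x.2 < letter w x.1).card

/-- Number of valleys: `1 ≤ i ≤ m` with `w_{i-1} > w_i < w_{i+1}`. -/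
def valley (w : List ℕ) : ℕ :=
  ((Finset.Icc 1 w.length).filter fun i =>
    letter w i < letter w (i - 1) ∧ letter w i < letter w (i + 1)).card

/-- Number of double descents: `1 ≤ i ≤ m` with `w_{i-1} > w_i > w_{i+1}`. -/
def dd (w : List ℕ) : ℕ :=
  ((Finset.Icc 1 w.length).filter fun i =>
    letter w i < letter w (i - 1) ∧ letter w (i + 1) < letter w i).card

/-- Number of pairs `2 ≤ i < j ≤ m` with `w_{i-1} > w_j > w_i`. -/
def les (w : List ℕ) : ℕ :=
  ((Finset.Icc 2 w.length ×ˢ Finset.Icc 2 w.length).filter fun x =>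
    x.1 < x.2 ∧ letter w x.2 < letter w (x.1 - 1) ∧ letter w x.1 < letter w x.2).card

/-- Number of pairs `1 ≤ i < j ≤ m - 1` with `w_{j+1} > w_i > w_j`. -/
def res (w : List ℕ) : ℕ :=
  ((Finset.Icc 1 (w.length - 1) ×ˢ Finset.Icc 1 (w.length - 1)).filter fun x =>
    x.1 < x.2 ∧ letter w x.1 < letter w (x.2 + 1) ∧ letter w x.2 < letter w x.1).card

/-- The set `𝒢_{n,k}` of permutations of `[n]` with `k` valleys and no double descent. -/
def permG (n k : ℕ) : Finset (Equiv.Perm (Fin n)) :=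
  Finset.univ.filter fun σ => valley (oneLine σ) = k ∧ dd (oneLine σ) = 0

/-- The subword consisting of the letters `1, …, k`, in their order of appearance. -/
def subword (w : List ℕ) (k : ℕ) : List ℕ := w.filter fun a => decide (a ≤ k)

/-- André permutations of `[n]`: for all `1 ≤ k ≤ n`, the subword of the letters `1, …, k` has
no double descent. As a `0` follows the last letter of a word, a last letter that is smaller than
its predecessor is a double descent; so a subword with at least two letters ends with an ascent. -/
def IsAndre {n : ℕ} (σ : Equiv.Perm (Fin n)) : Prop :=
  ∀ k ∈ Finset.Icc 1 n, dd (subword (oneLine σ) k) = 0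

instance {n : ℕ} : DecidablePred (IsAndre (n := n)) := fun σ =>
  inferInstanceAs (Decidable (∀ k ∈ Finset.Icc 1 n, dd (subword (oneLine σ) k) = 0))

/-- The set `𝔇_{n,k}` of André permutations of `[n]` with `k` descents. -/
def permD (n k : ℕ) : Finset (Equiv.Perm (Fin n)) :=
  Finset.univ.filter fun σ => IsAndre σ ∧ des (oneLine σ) = k

/-- `γ_{n,k}(p,q) = ∑_{σ ∈ 𝒢_{n,k}} p^{res σ} q^{les σ}`. -/
def gammaPoly {R : Type*} [CommRing R] (n k : ℕ) (p q : R) : R :=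
  ∑ σ ∈ permG n k, p ^ res (oneLine σ) * q ^ les (oneLine σ)

/-- `d_{n,k}(q) = ∑_{σ ∈ 𝔇_{n,k}} q^{2 res σ + les σ}`. -/
def dPoly {R : Type*} [CommRing R] (n k : ℕ) (q : R) : R :=
  ∑ σ ∈ permD n k, q ^ (2 * res (oneLine σ) + les (oneLine σ))

end AndrePerm

namespace AndrePerm

/-- The permutation that maps `i` to `c` and the remaining points as `τ` does, up to the
order-preserving relabelling. -/
def insertPerm {M : ℕ} (i c : Fin (M + 1)) (τ : Equiv.Perm (Fin M)) :
    Equiv.Perm (Fin (M + 1)) :=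
  (finSuccEquiv' i).trans ((Equiv.optionCongr τ).trans (finSuccEquiv' c).symm)

@[simp] theorem insertPerm_self {M : ℕ} (i c : Fin (M + 1)) (τ : Equiv.Perm (Fin M)) :
    insertPerm i c τ i = c := by
  simp [insertPerm]

@[simp] theorem insertPerm_succAbove {M : ℕ} (i c : Fin (M + 1)) (τ : Equiv.Perm (Fin M))
    (j : Fin M) : insertPerm i c τ (i.succAbove j) = c.succAbove (τ j) := by
  simp [insertPerm]

theorem insertPerm_inj {M : ℕ} {i c : Fin (M + 1)} {τ τ' : Equiv.Perm (Fin M)}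
    (h : insertPerm i c τ = insertPerm i c τ') : τ = τ' := by
  ext j : 1
  have h1 := congrArg (fun e => e (i.succAbove j)) h
  simpa using h1

/-- Sum over permutations according to the image of `i`. -/
theorem sum_perm_row {M : ℕ} {R : Type*} [AddCommMonoid R] (i : Fin (M + 1))
    (f : Equiv.Perm (Fin (M + 1)) → R) :
    ∑ σ, f σ = ∑ c, ∑ τ, f (insertPerm i c τ) := by
  have hb : Function.Bijective
      (fun x : Fin (M + 1) × Equiv.Perm (Fin M) => insertPerm i x.1 x.2) := by
    rw [Fintype.bijective_iff_injective_and_card]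
    constructor
    · rintro ⟨c, τ⟩ ⟨c', τ'⟩ h
      have h1 : c = c' := by simpa using congrArg (fun e => e i) h
      subst h1
      exact Prod.ext rfl (insertPerm_inj h)
    · simp [Fintype.card_perm, Nat.factorial_succ]
  rw [← Fintype.sum_prod_type', ← hb.sum_comp f]

/-- Sum over permutations according to the preimage of `c`. -/
theorem sum_perm_col {M : ℕ} {R : Type*} [AddCommMonoid R] (c : Fin (M + 1))
    (f : Equiv.Perm (Fin (M + 1)) → R) :
    ∑ σ, f σ = ∑ i, ∑ τ, f (insertPerm i c τ) := by
  have hb : Function.Bijective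
      (fun x : Fin (M + 1) × Equiv.Perm (Fin M) => insertPerm x.1 c x.2) := by
    rw [Fintype.bijective_iff_injective_and_card]
    constructor
    · rintro ⟨i, τ⟩ ⟨i', τ'⟩ h
      have h1 : i = i' := by
        have h2 := congrArg (fun e => e i) h
        simp only [insertPerm_self] at h2
        exact (insertPerm i' c τ').injective (by rw [← h2, insertPerm_self])
      subst h1
      exact Prod.ext rfl (insertPerm_inj h)
    · simp [Fintype.card_perm, Nat.factorial_succ]
  rw [← Fintype.sum_prod_type', ← hb.sum_comp f]

/-- Number of inversions. -/
def permInv {M : ℕ} (τ : Equiv.Perm (Fin M)) : ℕ :=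
  ∑ i, ∑ j, if i < j ∧ τ j < τ i then 1 else 0

/-- Number of excedances. -/
def permExc {M : ℕ} (τ : Equiv.Perm (Fin M)) : ℕ := ∑ i, if i < τ i then 1 else 0

theorem exists_lt_of_excedance {M : ℕ} (τ : Equiv.Perm (Fin M)) (i : Fin M) (h : i < τ i) :
    ∃ j, i < j ∧ τ j < τ i := by
  by_contra! hc
  have h1 : (Finset.Ici i).image τ ⊆ Finset.Ioi i := by
    intro x hx
    simp only [Finset.mem_image, Finset.mem_Ici] at hx
    obtain ⟨j, hj, rfl⟩ := hx
    rcases hj.eq_or_lt with rfl | hj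
    · simpa using h
    · simpa using h.trans_le (hc j hj)
  have h2 := Finset.card_le_card h1
  rw [Finset.card_image_of_injective _ τ.injective] at h2
  simp only [Fin.card_Ici, Fin.card_Ioi] at h2
  omega

theorem permExc_le_permInv {M : ℕ} (τ : Equiv.Perm (Fin M)) : permExc τ ≤ permInv τ := by
  refine Finset.sum_le_sum fun i _ => ?_
  split_ifs with h
  · obtain ⟨j, hj⟩ := exists_lt_of_excedance τ i h
    refine le_trans ?_ (Finset.single_le_sum (fun _ _ => Nat.zero_le _) (Finset.mem_univ j))
    simp [hj]
  · exact Nat.zero_le _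

theorem permInv_insertPerm {M : ℕ} (i c : Fin (M + 1)) (τ : Equiv.Perm (Fin M)) :
    permInv (insertPerm i c τ) = permInv τ
      + (∑ j, if i < i.succAbove j ∧ c.succAbove (τ j) < c then 1 else 0)
      + ∑ j, if i.succAbove j < i ∧ c < c.succAbove (τ j) then 1 else 0 := by
  unfold permInv
  rw [Fin.sum_univ_succAbove _ i, Fin.sum_univ_succAbove _ i]
  have : ∀ j : Fin M, (∑ k, if i.succAbove j < k ∧
      insertPerm i c τ k < insertPerm i c τ (i.succAbove j) then 1 else 0)
      = (if i.succAbove j < i ∧ c < c.succAbove (τ j) then 1 else 0)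
        + ∑ k, if j < k ∧ τ k < τ j then 1 else 0 := by
    intro j
    rw [Fin.sum_univ_succAbove _ i]
    simp
  simp only [this, Finset.sum_add_distrib]
  simp
  ring

theorem permExc_insertPerm {M : ℕ} (i c : Fin (M + 1)) (τ : Equiv.Perm (Fin M)) :
    permExc (insertPerm i c τ) = (if i < c then 1 else 0)
      + ∑ j, if i.succAbove j < c.succAbove (τ j) then 1 else 0 := by
  unfold permExc
  rw [Fin.sum_univ_succAbove _ i]
  simp

theorem succAbove_val {M : ℕ} (i : Fin (M + 1)) (j : Fin M) :
    (i.succAbove j).val = if j.val < i.val then j.val else j.val + 1 := by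
  unfold Fin.succAbove
  split_ifs <;> simp_all [Fin.lt_def]

theorem card_val_lt {M : ℕ} (h : ℕ) (hM : h ≤ M) :
    (∑ j : Fin M, if j.val < h then 1 else 0) = h := by
  rw [Fin.sum_univ_eq_sum_range (fun j => if j < h then 1 else 0) M, ← Finset.sum_filter]
  rw [Finset.sum_const, smul_eq_mul, mul_one]
  have : Finset.filter (fun j => j < h) (Finset.range M) = Finset.range h := by
    ext; simp; omega
  simp [this]

theorem card_perm_val_lt {M : ℕ} (τ : Equiv.Perm (Fin M)) (h : ℕ) (hM : h ≤ M) :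
    (∑ j : Fin M, if (τ j).val < h then 1 else 0) = h := by
  rw [Equiv.sum_comp τ (fun j : Fin M => if j.val < h then 1 else 0), card_val_lt h hM]

/-- Inserting the entry `(i, c)`, where the rows above `i` avoid the columns before `c` and
the rows holding those columns lie below `i`. -/
theorem permInv_insertPerm_of_avoid {M : ℕ} (i c : Fin (M + 1)) (τ : Equiv.Perm (Fin M))
    (h : ∀ j : Fin M, j.val < i.val → c.val ≤ (τ j).val) :
    permInv (insertPerm i c τ) = permInv τ + c + i := by
  rw [permInv_insertPerm]
  congr 1
  · congr 1
    rw [← card_perm_val_lt τ c.val (by omega)]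
    refine Finset.sum_congr rfl fun j _ => ?_
    have := h j
    congr 1
    simp only [Fin.lt_def, succAbove_val]
    apply propext
    split_ifs <;> omega
  · rw [← card_val_lt (M := M) i.val (by omega)]
    refine Finset.sum_congr rfl fun j _ => ?_
    have := h j
    congr 1
    simp only [Fin.lt_def, succAbove_val]
    apply propext
    split_ifs <;> omega

/-- The weight `q^(inv - exc) t^exc`. -/
def permWeight {R : Type*} [CommRing R] (q t : R) {M : ℕ} (τ : Equiv.Perm (Fin M)) : R :=
  q ^ (permInv τ - permExc τ) * t ^ permExc τ

open Classical in
/-- Weighted sum over the permutations that map none of the first `r` points to one of the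
first `c` points. -/
def avoidSum {R : Type*} [CommRing R] (q t : R) (M r c : ℕ) : R :=
  ∑ τ : Equiv.Perm (Fin M),
    if ∀ i : Fin M, i.val < r → c ≤ (τ i).val then permWeight q t τ else 0

theorem avoidSum_full {R : Type*} [CommRing R] (q t : R) (M : ℕ) :
    avoidSum q t M M M = if M = 0 then 1 else 0 := by
  unfold avoidSum
  rcases M with _ | M
  · simp [permWeight, permInv, permExc]
  · rw [Finset.sum_eq_zero]
    · simp
    · intro τ _
      rw [if_neg]
      intro h
      have h1 := h 0 (by simp)
      have := (τ 0).isLt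
      omega

theorem avoidSum_col {R : Type*} [CommRing R] (q t : R) (M h : ℕ) (hM : h ≤ M) :
    avoidSum q t (M + 1) h h = avoidSum q t (M + 1) h (h + 1)
      + (∑ i ∈ Finset.range h, t * q ^ (h - 1 + i)) * avoidSum q t M (h - 1) h := by
  classical
  let c : Fin (M + 1) := ⟨h, by omega⟩
  have key : avoidSum q t (M + 1) h h = avoidSum q t (M + 1) h (h + 1)
      + ∑ τ : Equiv.Perm (Fin (M + 1)),
        if (∀ i : Fin (M + 1), i.val < h → h ≤ (τ i).val) ∧ (τ.symm c).val < h
          then permWeight q t τ else 0 := by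
    unfold avoidSum
    rw [← Finset.sum_add_distrib]
    refine Finset.sum_congr rfl fun τ _ => ?_
    by_cases h1 : ∀ i : Fin (M + 1), i.val < h → h + 1 ≤ (τ i).val
    · rw [if_pos h1, if_pos fun i hi => (Nat.le_succ h).trans (h1 i hi), if_neg, add_zero]
      rintro ⟨-, h2⟩
      have := h1 _ h2
      simp [c] at this
    · rw [if_neg h1, zero_add]
      congr 1
      apply propext
      refine ⟨fun h2 => ⟨h2, ?_⟩, fun h2 => h2.1⟩
      push Not at h1
      obtain ⟨i, hi, hi'⟩ := h1
      have h3 : τ i = c := Fin.ext (by have := h2 i hi; simp [c]; omega)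
      rw [← h3]
      simpa using hi
  rw [key]
  congr 1
  rw [sum_perm_col c]
  have hsym : ∀ (i : Fin (M + 1)) (τ : Equiv.Perm (Fin M)), (insertPerm i c τ).symm c = i := by
    intro i τ
    rw [Equiv.symm_apply_eq]; simp
  have inner : ∀ i : Fin (M + 1), (∑ τ : Equiv.Perm (Fin M),
      if (∀ j : Fin (M + 1), j.val < h → h ≤ (insertPerm i c τ j).val) ∧
        ((insertPerm i c τ).symm c).val < h then permWeight q t (insertPerm i c τ) else 0)
      = if i.val < h then t * q ^ (h - 1 + i.val) * avoidSum q t M (h - 1) h else 0 := by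
    intro i
    split_ifs with hi
    · unfold avoidSum
      rw [Finset.mul_sum]
      refine Finset.sum_congr rfl fun τ _ => ?_
      rw [hsym]
      have hiff : ((∀ j : Fin (M + 1), j.val < h → h ≤ (insertPerm i c τ j).val) ∧ i.val < h)
          ↔ ∀ j : Fin M, j.val < h - 1 → h ≤ (τ j).val := by
        constructor
        · rintro ⟨h1, -⟩ j hj
          have := h1 (i.succAbove j) (by rw [succAbove_val]; split_ifs <;> omega)
          rw [insertPerm_succAbove, succAbove_val] at this
          simp only [c] at this
          split_ifs at this <;> omega
        · intro h1
          refine ⟨fun j hj => ?_, hi⟩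
          rcases Fin.eq_self_or_eq_succAbove i j with rfl | ⟨j, rfl⟩
          · simp [c]
          · rw [succAbove_val] at hj
            have := h1 j (by split_ifs at hj <;> omega)
            rw [insertPerm_succAbove, succAbove_val]
            simp only [c]
            split_ifs <;> omega
      rw [if_congr hiff rfl rfl]
      split_ifs with h1
      · have e1 : permInv (insertPerm i c τ) = permInv τ + h + i :=
          permInv_insertPerm_of_avoid i c τ fun j hj => h1 j (by omega)
        have e2 : permExc (insertPerm i c τ) = 1 + permExc τ := by
          rw [permExc_insertPerm, if_pos (show i < c from hi)]
          congr 1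
          refine Finset.sum_congr rfl fun j _ => ?_
          have := h1 j
          congr 1
          simp only [Fin.lt_def, succAbove_val, c]
          apply propext
          split_ifs <;> omega
        have := permExc_le_permInv τ
        unfold permWeight
        rw [e1, e2, show permInv τ + h + i.val - (1 + permExc τ)
          = (h - 1 + i.val) + (permInv τ - permExc τ) by omega]
        ring
      · simp
    · refine Finset.sum_eq_zero fun τ _ => ?_
      rw [if_neg]
      rw [hsym]
      tauto
  rw [Finset.sum_congr rfl fun i _ => inner i,
    Fin.sum_univ_eq_sum_range
      (fun i => if i < h then t * q ^ (h - 1 + i) * avoidSum q t M (h - 1) h else 0) (M + 1),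
    ← Finset.sum_filter, Finset.sum_mul]
  refine Finset.sum_congr ?_ fun _ _ => rfl
  ext; simp; omega

theorem avoidSum_row {R : Type*} [CommRing R] (q t : R) (M h : ℕ) (hM : h ≤ M) :
    avoidSum q t (M + 1) h (h + 1) = avoidSum q t (M + 1) (h + 1) (h + 1)
      + (∑ v ∈ Finset.range (h + 1), q ^ (h + v)) * avoidSum q t M h h := by
  classical
  let r : Fin (M + 1) := ⟨h, by omega⟩
  have key : avoidSum q t (M + 1) h (h + 1) = avoidSum q t (M + 1) (h + 1) (h + 1)
      + ∑ τ : Equiv.Perm (Fin (M + 1)),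
        if (∀ i : Fin (M + 1), i.val < h → h + 1 ≤ (τ i).val) ∧ (τ r).val < h + 1
          then permWeight q t τ else 0 := by
    unfold avoidSum
    rw [← Finset.sum_add_distrib]
    refine Finset.sum_congr rfl fun τ _ => ?_
    by_cases h1 : ∀ i : Fin (M + 1), i.val < h + 1 → h + 1 ≤ (τ i).val
    · rw [if_pos h1, if_pos fun i hi => h1 i (by omega), if_neg, add_zero]
      rintro ⟨-, h2⟩
      have := h1 r (by simp [r])
      omega
    · rw [if_neg h1, zero_add]
      congr 1
      apply propext
      refine ⟨fun h2 => ⟨h2, ?_⟩, fun h2 => h2.1⟩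
      push Not at h1
      obtain ⟨i, hi, hi'⟩ := h1
      have h3 : i = r := Fin.ext (by
        by_contra hne
        simp only [r] at hne
        have := h2 i (by omega)
        omega)
      rw [← h3]
      exact hi'
  rw [key]
  congr 1
  rw [sum_perm_row r]
  have inner : ∀ v : Fin (M + 1), (∑ τ : Equiv.Perm (Fin M),
      if (∀ j : Fin (M + 1), j.val < h → h + 1 ≤ (insertPerm r v τ j).val) ∧
        (insertPerm r v τ r).val < h + 1 then permWeight q t (insertPerm r v τ) else 0)
      = if v.val < h + 1 then q ^ (h + v.val) * avoidSum q t M h h else 0 := by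
    intro v
    split_ifs with hv
    · unfold avoidSum
      rw [Finset.mul_sum]
      refine Finset.sum_congr rfl fun τ _ => ?_
      have hiff : ((∀ j : Fin (M + 1), j.val < h → h + 1 ≤ (insertPerm r v τ j).val) ∧
          (insertPerm r v τ r).val < h + 1) ↔ ∀ j : Fin M, j.val < h → h ≤ (τ j).val := by
        rw [insertPerm_self]
        constructor
        · rintro ⟨h1, -⟩ j hj
          have := h1 (r.succAbove j) (by rw [succAbove_val]; simp only [r]; split_ifs; omega)
          rw [insertPerm_succAbove, succAbove_val] at this
          split_ifs at this <;> omega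
        · intro h1
          refine ⟨fun j hj => ?_, hv⟩
          rcases Fin.eq_self_or_eq_succAbove r j with rfl | ⟨j, rfl⟩
          · simp [r] at hj
          · rw [succAbove_val] at hj
            simp only [r] at hj
            have := h1 j (by split_ifs at hj <;> omega)
            rw [insertPerm_succAbove, succAbove_val]
            split_ifs <;> omega
      rw [if_congr hiff rfl rfl]
      split_ifs with h1
      · have e1 : permInv (insertPerm r v τ) = permInv τ + v + h :=
          permInv_insertPerm_of_avoid r v τ fun j hj => by
            have := h1 j hj
            omega
        have e2 : permExc (insertPerm r v τ) = permExc τ := by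
          rw [permExc_insertPerm, if_neg (show ¬ r < v by simp [Fin.lt_def, r]; omega), zero_add]
          refine Finset.sum_congr rfl fun j _ => ?_
          have := h1 j
          congr 1
          simp only [Fin.lt_def, succAbove_val, r]
          apply propext
          split_ifs <;> omega
        have := permExc_le_permInv τ
        unfold permWeight
        rw [e1, e2, show permInv τ + v.val + h - permExc τ
          = (h + v.val) + (permInv τ - permExc τ) by omega]
        ring
      · simp
    · refine Finset.sum_eq_zero fun τ _ => ?_
      rw [if_neg]
      rw [insertPerm_self]
      tauto
  rw [Finset.sum_congr rfl fun i _ => inner i,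
    Fin.sum_univ_eq_sum_range
      (fun v => if v < h + 1 then q ^ (h + v) * avoidSum q t M h h else 0) (M + 1),
    ← Finset.sum_filter, Finset.sum_mul]
  refine Finset.sum_congr ?_ fun _ _ => rfl
  ext; simp; omega

/-- The `(p, q)`-analogue of `m`. -/
def bracket {R : Type*} [CommRing R] (p q : R) (m : ℕ) : R :=
  ∑ i ∈ Finset.range m, p ^ (m - 1 - i) * q ^ i

theorem bracket_zero {R : Type*} [CommRing R] (p q : R) : bracket p q 0 = 0 := by
  simp [bracket]

theorem bracket_one {R : Type*} [CommRing R] (p q : R) : bracket p q 1 = 1 := by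
  simp [bracket]

theorem bracket_succ {R : Type*} [CommRing R] (p q : R) (m : ℕ) :
    bracket p q (m + 1) = p ^ m + q * bracket p q m := by
  unfold bracket
  rw [Finset.sum_range_succ', add_comm, Finset.mul_sum]
  congr 1
  · simp
  · refine Finset.sum_congr rfl fun i hi => ?_
    rw [show m + 1 - 1 - (i + 1) = m - 1 - i by omega]
    ring

theorem bracket_sq {R : Type*} [CommRing R] (q : R) (m : ℕ) :
    bracket (q ^ 2) q m = ∑ i ∈ Finset.range m, q ^ (m - 1 + i) := by
  rw [← Finset.sum_range_reflect]
  refine Finset.sum_congr rfl fun i hi => ?_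
  rw [← pow_mul, ← pow_add]
  congr 1
  have := Finset.mem_range.1 hi
  omega

/-- Weight of a down step from height `e`. -/
def downWeight {R : Type*} [CommRing R] (q t : R) (e : ℕ) : R :=
  if e % 2 = 0 then t * bracket (q ^ 2) q (e / 2) else bracket (q ^ 2) q (e / 2 + 1)

/-- Weighted count of the paths with `s` steps from height `e` to height `0`. -/
def dyckSum {R : Type*} [CommRing R] (q t : R) : ℕ → ℕ → R
  | 0, e => if e = 0 then 1 else 0
  | s + 1, e => dyckSum q t s (e + 1) + downWeight q t e * dyckSum q t s (e - 1)

theorem avoidSum_eq_dyckSum {R : Type*} [CommRing R] (q t : R) (s : ℕ) :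
    (∀ M h, 2 * h + s = 2 * M → avoidSum q t M h h = dyckSum q t s (2 * h)) ∧
    (∀ M h, 2 * h + 1 + s = 2 * M → avoidSum q t M h (h + 1) = dyckSum q t s (2 * h + 1)) := by
  induction s with
  | zero =>
    constructor
    · intro M h hM
      obtain rfl : h = M := by omega
      rw [avoidSum_full, dyckSum]
      simp
    · intro M h hM
      omega
  | succ s ih =>
    constructor
    · intro M h hM
      obtain ⟨M, rfl⟩ : ∃ M', M = M' + 1 := ⟨M - 1, by omega⟩
      rw [avoidSum_col q t M h (by omega), dyckSum, ih.2 _ _ (by omega), ← Finset.mul_sum,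
        ← bracket_sq, downWeight, if_pos (by omega), show 2 * h / 2 = h by omega]
      rcases h with _ | h
      · simp [bracket_zero]
      · rw [show h + 1 - 1 = h from rfl, ih.2 M h (by omega)]
        rfl
    · intro M h hM
      obtain ⟨M, rfl⟩ : ∃ M', M = M' + 1 := ⟨M - 1, by omega⟩
      rw [avoidSum_row q t M h (by omega), dyckSum, ih.1 _ _ (by omega), ih.1 _ _ (by omega),
        downWeight, if_neg (by omega), show (2 * h + 1) / 2 + 1 = h + 1 by omega, bracket_sq]
      rfl

/-- Weighted count of Motzkin paths with `N` steps from height `m` to height `0`. -/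
def motzkinSum {R : Type*} [CommRing R] (p q x y : R) : ℕ → ℕ → R
  | 0, m => if m = 0 then 1 else 0
  | N + 1, m => bracket p q m * (motzkinSum p q x y N (m - 1) + y * motzkinSum p q x y N m
      + x * motzkinSum p q x y N (m + 1))

theorem dyckSum_odd {R : Type*} [CommRing R] (q t : R) (N m : ℕ) :
    dyckSum q t (2 * N + 1) (2 * m + 1)
      = (∏ i ∈ Finset.range m, t * bracket (q ^ 2) q (i + 1))
        * motzkinSum (q ^ 2) q t (1 + t) (N + 1) (m + 1) := by
  induction N generalizing m with
  | zero =>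
    rcases m with _ | m
    · simp [dyckSum, motzkinSum, downWeight, bracket_one]
    · simp [dyckSum, motzkinSum]
  | succ N ih =>
    have e1 : dyckSum q t (2 * (N + 1) + 1) (2 * m + 1)
        = dyckSum q t (2 * N + 1) (2 * (m + 1) + 1)
          + downWeight q t (2 * m + 2) * dyckSum q t (2 * N + 1) (2 * m + 1)
          + downWeight q t (2 * m + 1) * (dyckSum q t (2 * N + 1) (2 * m + 1)
            + downWeight q t (2 * m) * dyckSum q t (2 * N + 1) (2 * m - 1)) := by
      rfl
    have d1 : downWeight q t (2 * m + 2) = t * bracket (q ^ 2) q (m + 1) := by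
      rw [downWeight, if_pos (by omega), show (2 * m + 2) / 2 = m + 1 by omega]
    have d2 : downWeight q t (2 * m + 1) = bracket (q ^ 2) q (m + 1) := by
      rw [downWeight, if_neg (by omega), show (2 * m + 1) / 2 + 1 = m + 1 by omega]
    have d3 : downWeight q t (2 * m) = t * bracket (q ^ 2) q m := by
      rw [downWeight, if_pos (by omega), show 2 * m / 2 = m by omega]
    rw [e1, d1, d2, d3, motzkinSum, ih, ih]
    rcases m with _ | m
    · have : motzkinSum (q ^ 2) q t (1 + t) (N + 1) 0 = 0 := by
        simp [motzkinSum, bracket_zero]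
      simp [bracket_zero, this, bracket_one]
      ring
    · rw [show 2 * (m + 1) - 1 = 2 * m + 1 by omega, ih, Finset.prod_range_succ,
        Finset.prod_range_succ, show m + 1 + 1 - 1 = m + 1 from rfl]
      ring

theorem sum_permWeight {R : Type*} [CommRing R] (q t : R) (n : ℕ) (hn : 1 ≤ n) :
    ∑ σ : Equiv.Perm (Fin n), permWeight q t σ = motzkinSum (q ^ 2) q t (1 + t) n 1 := by
  obtain ⟨N, rfl⟩ : ∃ N, n = N + 1 := ⟨n - 1, by omega⟩
  have h1 := (avoidSum_eq_dyckSum q t (2 * (N + 1))).1 (N + 1) 0 (by omega)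
  have h2 : dyckSum q t (2 * (N + 1)) (2 * 0) = dyckSum q t (2 * N + 1) (2 * 0 + 1) := by
    change dyckSum q t (2 * N + 1) (2 * 0 + 1) + downWeight q t 0 * _ = _
    simp [downWeight, bracket_zero]
  rw [h2, dyckSum_odd] at h1
  simpa [avoidSum] using h1


/-- Puts a hole (the letter `0`) in front of a word, unless it starts with one. -/
def consHole (w : List ℕ) : List ℕ := if w.headD 1 = 0 then w else 0 :: w

/-- Replaces every maximal block of letters outside `1, …, k` by a hole. -/
def trunc (k : ℕ) : List ℕ → List ℕ
  | [] => []
  | a :: w => if 1 ≤ a ∧ a ≤ k then a :: trunc k w else consHole (trunc k w)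

/-- No two adjacent letters are holes. -/
def Collapsed : List ℕ → Prop
  | [] => True
  | a :: w => (a = 0 → w.headD 1 ≠ 0) ∧ Collapsed w

/-- Removes a hole at the end. -/
def dropLastHole : List ℕ → List ℕ
  | [] => []
  | a :: w => if w = [] then (if a = 0 then [] else [a]) else a :: dropLastHole w

/-- Removes a hole at the start. -/
def dropHeadHole (w : List ℕ) : List ℕ := if w.headD 1 = 0 then w.tail else w

/-- An optional hole. -/
def optHole (b : Bool) : List ℕ := if b then [0] else []

theorem getLastD_cons_of_ne_nil {a d : ℕ} {w : List ℕ} (h : w ≠ []) :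
    (a :: w).getLastD d = w.getLastD d := by
  cases w with
  | nil => exact absurd rfl h
  | cons b w => simp [List.getLastD]

theorem dropLastHole_append_optHole (w : List ℕ) :
    dropLastHole w ++ optHole (decide (w.getLastD 1 = 0)) = w := by
  induction w with
  | nil => rfl
  | cons a w ih =>
    unfold dropLastHole
    by_cases hw : w = []
    · subst hw
      by_cases ha : a = 0 <;> simp [ha, optHole]
    · rw [if_neg hw, getLastD_cons_of_ne_nil hw, List.cons_append, ih]

theorem optHole_append_dropHeadHole (w : List ℕ) :
    optHole (decide (w.headD 1 = 0)) ++ dropHeadHole w = w := by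
  cases w with
  | nil => rfl
  | cons a w => by_cases ha : a = 0 <;> simp [optHole, dropHeadHole, ha]

theorem dropLastHole_append (A : List ℕ) (l : Bool) (hA : A.getLastD 1 ≠ 0) :
    dropLastHole (A ++ optHole l) = A := by
  induction A with
  | nil => cases l <;> rfl
  | cons a A ih =>
    by_cases h : A = []
    · subst h
      have : a ≠ 0 := by simpa using hA
      cases l <;> simp [dropLastHole, optHole, this]
    · rw [getLastD_cons_of_ne_nil h] at hA
      rw [List.cons_append, dropLastHole, if_neg (by simp [h]), ih hA]

theorem getLastD_append_optHole (A : List ℕ) (l : Bool) (hA : A.getLastD 1 ≠ 0) :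
    decide ((A ++ optHole l).getLastD 1 = 0) = l := by
  cases l <;> simp [optHole] at hA ⊢
  exact hA

theorem dropHeadHole_append (B : List ℕ) (r : Bool) (hB : B.headD 1 ≠ 0) :
    dropHeadHole (optHole r ++ B) = B := by
  cases r
  · simp only [optHole, Bool.false_eq_true, if_false, List.nil_append, dropHeadHole, if_neg hB]
  · simp [optHole, dropHeadHole]

theorem headD_optHole_append (B : List ℕ) (r : Bool) (hB : B.headD 1 ≠ 0) :
    decide ((optHole r ++ B).headD 1 = 0) = r := by
  cases r <;> simp [optHole] at hB ⊢
  exact hB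

theorem consHole_eq (w : List ℕ) : consHole w = 0 :: dropHeadHole w := by
  cases w with
  | nil => rfl
  | cons a w => by_cases ha : a = 0 <;> simp [consHole, dropHeadHole, ha]

theorem collapsed_append (A B : List ℕ) : Collapsed (A ++ B) ↔
    Collapsed A ∧ Collapsed B ∧ (A.getLastD 1 = 0 → B.headD 1 ≠ 0) := by
  induction A with
  | nil => simp [Collapsed]
  | cons a A ih =>
    cases A with
    | nil => simp [Collapsed]; tauto
    | cons b A =>
      rw [getLastD_cons_of_ne_nil (by simp), List.cons_append, Collapsed, ih, Collapsed]
      simp only [List.cons_append, List.headD_cons, Collapsed]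
      tauto

theorem trunc_append_cons (k c : ℕ) (u v : List ℕ) (h1 : 1 ≤ c) (h2 : c ≤ k) :
    trunc k (u ++ c :: v) = trunc k u ++ c :: trunc k v := by
  induction u with
  | nil => simp [trunc, h1, h2]
  | cons a u ih =>
    simp only [List.cons_append, trunc, ih]
    split_ifs
    · rfl
    · unfold consHole
      rcases trunc k u with _ | ⟨b, t⟩
      · simp; omega
      · by_cases hb : b = 0 <;> simp [hb]

theorem dropLastHole_consHole (T B : List ℕ) :
    consHole (dropLastHole T ++ 0 :: B) = dropLastHole (consHole T) ++ 0 :: B := by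
  rcases T with _ | ⟨a, _ | ⟨b, T⟩⟩
  · simp [consHole, dropLastHole]
  · by_cases ha : a = 0 <;> simp [ha, consHole, dropLastHole]
  · by_cases ha : a = 0 <;> simp [ha, consHole, dropLastHole]

theorem trunc_append_hole (k : ℕ) (a v B : List ℕ) (hv : trunc k v = 0 :: B) :
    trunc k (a ++ v) = dropLastHole (trunc k a) ++ 0 :: B := by
  induction a with
  | nil => simp [trunc, hv, dropLastHole]
  | cons c a ih =>
    simp only [List.cons_append, trunc, ih]
    split_ifs with h
    · rw [dropLastHole]
      split_ifs with h1 h2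
      · omega
      · simp [h1, dropLastHole]
      · rfl
    · exact dropLastHole_consHole _ _

theorem trunc_succ_of_notMem (k : ℕ) (a : List ℕ) (h : k + 1 ∉ a) :
    trunc (k + 1) a = trunc k a := by
  induction a with
  | nil => rfl
  | cons c a ih =>
    simp only [List.mem_cons, not_or] at h
    simp only [trunc, ih h.2]
    congr 1
    apply propext
    have := h.1
    omega

theorem mem_trunc {k c : ℕ} {a : List ℕ} (h : c ∈ trunc k a) : c = 0 ∨ c ∈ a := by
  induction a with
  | nil => simp [trunc] at h
  | cons b a ih =>
    simp only [trunc] at h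
    split_ifs at h with hb
    · rcases List.mem_cons.1 h with rfl | h
      · simp
      · rcases ih h with h | h <;> simp [h]
    · have : c = 0 ∨ c ∈ trunc k a := by
        unfold consHole at h
        split_ifs at h
        · exact Or.inr h
        · simpa using h
      rcases this with h | h
      · exact Or.inl h
      · rcases ih h with h | h <;> simp [h]

theorem trunc_of_le (k : ℕ) (a : List ℕ) (h : ∀ c ∈ a, 1 ≤ c ∧ c ≤ k) : trunc k a = a := by
  induction a with
  | nil => rfl
  | cons c a ih =>
    rw [trunc, if_pos (h c (by simp)), ih fun d hd => h d (by simp [hd])]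

theorem trunc_of_gt (k : ℕ) (a : List ℕ) (h : ∀ c ∈ a, k < c) (ha : a ≠ []) : trunc k a = [0] := by
  induction a with
  | nil => exact absurd rfl ha
  | cons c a ih =>
    rw [trunc, if_neg (by have := h c (by simp); omega)]
    by_cases h0 : a = []
    · subst h0; rfl
    · rw [ih (fun d hd => h d (by simp [hd])) h0]; rfl

/-- All ways to write a word as `A 0 B`. -/
def splits : List ℕ → List (List ℕ × List ℕ)
  | [] => []
  | a :: w => (if a = 0 then [([], w)] else []) ++ (splits w).map fun s => (a :: s.1, s.2)

theorem mem_splits {w A B : List ℕ} : (A, B) ∈ splits w ↔ w = A ++ 0 :: B := by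
  induction w generalizing A with
  | nil => simp [splits]
  | cons a w ih =>
    rw [splits, List.mem_append, List.mem_map]
    rcases A with _ | ⟨b, A⟩
    · by_cases ha : a = 0
      · simp [ha]; exact eq_comm
      · simp [ha]
    · constructor
      · rintro (h | ⟨⟨A', B'⟩, h, h'⟩)
        · split_ifs at h <;> simp at h
        · simp only [Prod.mk.injEq, List.cons.injEq] at h'
          obtain ⟨⟨rfl, rfl⟩, rfl⟩ := h'
          simp [ih.1 h]
      · intro h
        simp only [List.cons_append, List.cons.injEq] at h
        exact Or.inr ⟨(A, B), ih.2 h.2, by simp [h.1]⟩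

theorem nodup_splits (w : List ℕ) : (splits w).Nodup := by
  induction w with
  | nil => simp [splits]
  | cons a w ih =>
    rw [splits, List.nodup_append]
    refine ⟨by split_ifs <;> simp, ih.map ?_, ?_⟩
    · rintro ⟨A, B⟩ ⟨A', B'⟩ h
      simpa using h
    · rintro s hs s' hs' rfl
      simp only [List.mem_map] at hs'
      obtain ⟨x, -, rfl⟩ := hs'
      split_ifs at hs <;> simp at hs

/-- The word `A 0 B` with its marked hole replaced by the letter `k` and holes around it. -/
def child (k : ℕ) (A : List ℕ) (l r : Bool) (B : List ℕ) : List ℕ :=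
  (A ++ optHole l) ++ k :: (optHole r ++ B)

/-- Weighted sum over all ways of filling the holes of `w` by `N` letters `k + 1, …, k + N`. -/
def treeSum {R : Type*} [CommRing R] (F : ℕ → List ℕ → Bool → Bool → List ℕ → R) :
    ℕ → ℕ → List ℕ → R
  | 0, _, w => if 0 ∈ w then 0 else 1
  | N + 1, k, w => ((splits w).map fun s => ∑ l : Bool, ∑ r : Bool,
      F (k + 1) s.1 l r s.2 * treeSum F N (k + 1) (child (k + 1) s.1 l r s.2)).sum

/-- The part of `w` before the letter `j`. -/
def before (j : ℕ) (w : List ℕ) : List ℕ := w.takeWhile (· ≠ j)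

/-- The part of `w` after the letter `j`. -/
def after (j : ℕ) (w : List ℕ) : List ℕ := (w.dropWhile (· ≠ j)).tail

theorem before_eq {j : ℕ} {a b : List ℕ} (h : j ∉ a) : before j (a ++ j :: b) = a := by
  unfold before
  rw [List.takeWhile_append_of_pos]
  · simp
  · intro c hc
    simp only [ne_eq, decide_not, Bool.not_eq_eq_eq_not, Bool.not_true, decide_eq_false_iff_not]
    rintro rfl; exact h hc

theorem after_eq {j : ℕ} {a b : List ℕ} (h : j ∉ a) : after j (a ++ j :: b) = b := by
  unfold after
  rw [List.dropWhile_append_of_pos]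
  · simp
  · intro c hc
    simp only [ne_eq, decide_not, Bool.not_eq_eq_eq_not, Bool.not_true, decide_eq_false_iff_not]
    rintro rfl; exact h hc

/-- The position of the hole of the word truncated below `j` in which `j` is inserted, and
whether holes remain to its left and right. -/
def code (j : ℕ) (w : List ℕ) : (List ℕ × List ℕ) × Bool × Bool :=
  ((dropLastHole (trunc j (before j w)), dropHeadHole (trunc j (after j w))),
    decide ((trunc j (before j w)).getLastD 1 = 0), decide ((trunc j (after j w)).headD 1 = 0))

theorem exists_split {j : ℕ} {w : List ℕ} (hw : w.Nodup) (hj : j ∈ w) :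
    w = before j w ++ j :: after j w ∧ j ∉ before j w ∧ j ∉ after j w := by
  obtain ⟨a, b, rfl⟩ := List.append_of_mem hj
  rw [List.nodup_middle, List.nodup_cons, List.mem_append, not_or] at hw
  rw [before_eq hw.1.1, after_eq hw.1.1]
  exact ⟨rfl, hw.1⟩

theorem trunc_succ_eq_child {k : ℕ} {w : List ℕ} (hw : w.Nodup) (hj : k + 1 ∈ w) :
    trunc (k + 1) w = child (k + 1) (code (k + 1) w).1.1 (code (k + 1) w).2.1
      (code (k + 1) w).2.2 (code (k + 1) w).1.2 := by
  obtain ⟨h, -, -⟩ := exists_split hw hj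
  unfold child code
  rw [dropLastHole_append_optHole, optHole_append_dropHeadHole]
  nth_rw 1 [h]
  rw [trunc_append_cons _ _ _ _ (by omega) le_rfl]

theorem trunc_eq_code {k : ℕ} {w : List ℕ} (hw : w.Nodup) (hj : k + 1 ∈ w) :
    trunc k w = (code (k + 1) w).1.1 ++ 0 :: (code (k + 1) w).1.2 := by
  obtain ⟨h, ha, hb⟩ := exists_split hw hj
  unfold code
  rw [trunc_succ_of_notMem _ _ ha, trunc_succ_of_notMem _ _ hb]
  nth_rw 1 [h]
  refine trunc_append_hole _ _ _ _ ?_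
  rw [trunc, if_neg (by omega), consHole_eq]

theorem code_eq_of_trunc_succ_eq_child {k : ℕ} {w A B : List ℕ} {l r : Bool} (hw : w.Nodup)
    (hj : k + 1 ∈ w) (hA : k + 1 ∉ A) (hAl : A.getLastD 1 ≠ 0) (hBh : B.headD 1 ≠ 0)
    (h : trunc (k + 1) w = child (k + 1) A l r B) : code (k + 1) w = ((A, B), l, r) := by
  obtain ⟨hs, ha, hb⟩ := exists_split hw hj
  have h1 : trunc (k + 1) w =
      trunc (k + 1) (before (k + 1) w) ++ (k + 1) :: trunc (k + 1) (after (k + 1) w) := by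
    nth_rw 1 [hs]
    rw [trunc_append_cons _ _ _ _ (by omega) le_rfl]
  rw [h, child] at h1
  have n1 : k + 1 ∉ A ++ optHole l := by cases l <;> simp [optHole, hA]
  have n2 : k + 1 ∉ trunc (k + 1) (before (k + 1) w) := fun hm => by
    rcases mem_trunc hm with h | h
    · omega
    · exact ha h
  have e1 := congrArg (before (k + 1)) h1
  have e2 := congrArg (after (k + 1)) h1
  rw [before_eq n1, before_eq n2] at e1
  rw [after_eq n1, after_eq n2] at e2
  unfold code
  rw [← e1, ← e2, dropLastHole_append _ _ hAl, dropHeadHole_append _ _ hBh,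
    getLastD_append_optHole _ _ hAl, headD_optHole_append _ _ hBh]

/-- The words obtained from permutations by truncation to the letters `1, …, k`. -/
structure IsPartial (k : ℕ) (w : List ℕ) : Prop where
  le : ∀ c ∈ w, c ≤ k
  collapsed : Collapsed w
  count : ∀ c, 1 ≤ c → c ≤ k → w.count c = 1

theorem IsPartial.ends {k : ℕ} {A B : List ℕ} (h : IsPartial k (A ++ 0 :: B)) :
    A.getLastD 1 ≠ 0 ∧ B.headD 1 ≠ 0 := by
  have h1 := (collapsed_append _ _).1 h.collapsed
  exact ⟨fun h0 => by simpa using h1.2.2 h0, h1.2.1.1 rfl⟩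

theorem collapsed_child {k : ℕ} {A B : List ℕ} (l r : Bool) (h : Collapsed (A ++ 0 :: B))
    (hk : k ≠ 0) : Collapsed (child k A l r B) := by
  have h1 := (collapsed_append _ _).1 h
  have h2 := h1.2.1
  simp only [Collapsed, forall_const, List.headD_cons, ne_eq, not_true_eq_false, imp_false] at h1 h2
  unfold child
  rw [collapsed_append, collapsed_append, Collapsed, collapsed_append]
  refine ⟨⟨h1.1, ?_, fun h0 => absurd h0 h1.2.2⟩, ⟨fun h0 => absurd h0 hk, ?_, h2.2, ?_⟩, ?_⟩
  · cases l <;> simp [optHole, Collapsed]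
  · cases r <;> simp [optHole, Collapsed]
  · exact fun _ => h2.1
  · exact fun _ => by simpa using hk

theorem IsPartial.child {k : ℕ} {A B : List ℕ} (l r : Bool) (h : IsPartial k (A ++ 0 :: B)) :
    IsPartial (k + 1) (child (k + 1) A l r B) := by
  refine ⟨fun c hc => ?_, collapsed_child l r h.collapsed (by omega), fun c h1 h2 => ?_⟩
  · have := h.le c
    simp only [AndrePerm.child, List.mem_append, List.mem_cons] at hc this
    rcases hc with (hc | hc) | hc | hc | hc
    · have := this (Or.inl hc); omega
    · cases l <;> simp [optHole] at hc; omega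
    · omega
    · cases r <;> simp [optHole] at hc; omega
    · have := this (Or.inr (Or.inr hc)); omega
  · have e : ∀ b, (optHole b).count c = 0 := by
      intro b; cases b <;> simp [optHole, List.count_cons]; omega
    have e1 : (AndrePerm.child (k + 1) A l r B).count c
        = (A ++ 0 :: B).count c + if c = k + 1 then 1 else 0 := by
      simp only [AndrePerm.child, List.count_append, List.count_cons, e, beq_iff_eq]
      rw [if_neg (show ¬ 0 = c by omega), if_congr (eq_comm (a := k + 1)) rfl rfl]
      omega
    rw [e1]
    split_ifs with hc
    · rw [List.count_eq_zero_of_not_mem]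
      intro hm
      have := h.le c hm
      omega
    · rw [h.count c h1 (by omega)]

theorem length_oneLine {n : ℕ} (σ : Equiv.Perm (Fin n)) : (oneLine σ).length = n := by
  simp [oneLine]

theorem nodup_oneLine {n : ℕ} (σ : Equiv.Perm (Fin n)) : (oneLine σ).Nodup := by
  unfold oneLine
  rw [List.nodup_ofFn]
  intro i j h
  simpa [Fin.val_inj] using h

theorem mem_oneLine {n : ℕ} (σ : Equiv.Perm (Fin n)) {j : ℕ} :
    j ∈ oneLine σ ↔ 1 ≤ j ∧ j ≤ n := by
  unfold oneLine
  rw [List.mem_ofFn]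
  constructor
  · rintro ⟨i, rfl⟩
    simp only [le_add_iff_nonneg_left, zero_le, true_and]
    exact (σ i).isLt
  · rintro ⟨h1, h2⟩
    exact ⟨σ.symm ⟨j - 1, by omega⟩, by simp; omega⟩

theorem oneLine_injective {n : ℕ} : Function.Injective (oneLine (n := n)) := by
  intro σ τ h
  have h1 := List.ofFn_injective h
  ext i
  simpa using congrFun h1 i

theorem exists_oneLine_eq {n : ℕ} {w : List ℕ} (h : IsPartial n w) (h0 : 0 ∉ w) :
    ∃ σ : Equiv.Perm (Fin n), oneLine σ = w := by
  have hmem : ∀ c ∈ w, 1 ≤ c ∧ c ≤ n := fun c hc =>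
    ⟨Nat.one_le_iff_ne_zero.2 fun hc0 => h0 (hc0 ▸ hc), h.le c hc⟩
  have hnd : w.Nodup := by
    rw [List.nodup_iff_count_le_one]
    intro c
    by_cases hc : c ∈ w
    · rw [h.count c (hmem c hc).1 (hmem c hc).2]
    · rw [List.count_eq_zero_of_not_mem hc]; omega
  have hlen : w.length = n := by
    have : w.toFinset = Finset.Icc 1 n := by
      ext c
      rw [List.mem_toFinset, Finset.mem_Icc]
      refine ⟨hmem c, fun hc => ?_⟩
      rw [← List.count_pos_iff, h.count c hc.1 hc.2]
      omega
    rw [← List.toFinset_card_of_nodup hnd, this]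
    simp
  subst hlen
  let f : Fin w.length → Fin w.length := fun i => ⟨w[i] - 1, by
    have := hmem _ (List.getElem_mem i.isLt)
    simp only [Fin.getElem_fin]
    omega⟩
  have hf : Function.Injective f := by
    intro i j hij
    have h1 := hmem _ (List.getElem_mem i.isLt)
    have h2 := hmem _ (List.getElem_mem j.isLt)
    simp only [f, Fin.mk.injEq, Fin.getElem_fin] at hij
    have h3 : w[i.val] = w[j.val] := by omega
    exact Fin.ext ((List.Nodup.getElem_inj_iff hnd).1 h3)
  refine ⟨Equiv.ofBijective f (Finite.injective_iff_bijective.1 hf), ?_⟩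
  unfold oneLine
  refine List.ext_getElem (by simp) fun i h1 h2 => ?_
  have := hmem _ (List.getElem_mem h2)
  simp [f]
  omega

/-- The sum over all permutations with a given truncation, of a product of weights of the
insertion steps, is a sum over a generating tree. -/
theorem sum_prod_code {R : Type*} [CommRing R] (F : ℕ → List ℕ → Bool → Bool → List ℕ → R)
    (n N k : ℕ) (hk : k + N = n) (w : List ℕ) (hw : IsPartial k w) :
    ∑ σ : Equiv.Perm (Fin n) with trunc k (oneLine σ) = w, ∏ j ∈ Finset.Ioc k n,
        F j (code j (oneLine σ)).1.1 (code j (oneLine σ)).2.1 (code j (oneLine σ)).2.2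
          (code j (oneLine σ)).1.2
      = treeSum F N k w := by
  induction N generalizing k w with
  | zero =>
    obtain rfl : k = n := by omega
    have htr : ∀ σ : Equiv.Perm (Fin k), trunc k (oneLine σ) = oneLine σ := fun σ =>
      trunc_of_le _ _ fun c hc => (mem_oneLine σ).1 hc
    simp only [htr, Finset.Ioc_self, Finset.prod_empty, treeSum]
    split_ifs with h0
    · refine Finset.sum_eq_zero fun σ hσ => ?_
      exfalso
      rw [Finset.mem_filter] at hσ
      rw [← hσ.2, mem_oneLine] at h0
      omega
    · obtain ⟨σ, hσ⟩ := exists_oneLine_eq hw h0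
      rw [show Finset.univ.filter (fun τ : Equiv.Perm (Fin k) => oneLine τ = w) = {σ} by
        ext τ
        simp only [Finset.mem_filter, Finset.mem_univ, true_and, Finset.mem_singleton]
        rw [← hσ]
        exact oneLine_injective.eq_iff]
      simp
  | succ N ih =>
    have hmem : ∀ σ : Equiv.Perm (Fin n), k + 1 ∈ oneLine σ := fun σ =>
      (mem_oneLine σ).2 ⟨by omega, by omega⟩
    rw [treeSum, ← List.sum_toFinset _ (nodup_splits w)]
    simp only [← Finset.sum_product']
    rw [← Finset.sum_fiberwise_of_maps_to
      (t := (splits w).toFinset ×ˢ (Finset.univ ×ˢ Finset.univ))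
      (g := fun σ => code (k + 1) (oneLine σ))]
    · refine Finset.sum_congr rfl ?_
      rintro ⟨⟨A, B⟩, l, r⟩ hc
      simp only [Finset.mem_product, List.mem_toFinset, mem_splits, Finset.mem_univ,
        and_true] at hc
      subst hc
      have hk1 : k + 1 ∉ A := fun hA => by
        have := hw.le (k + 1) (by simp [hA])
        omega
      dsimp only
      rw [← ih (k + 1) (by omega) _ (hw.child l r), Finset.mul_sum]
      have hset : (Finset.univ.filter fun σ : Equiv.Perm (Fin n) =>
            trunc k (oneLine σ) = A ++ 0 :: B).filter
            (fun σ => code (k + 1) (oneLine σ) = ((A, B), l, r))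
          = Finset.univ.filter fun σ : Equiv.Perm (Fin n) =>
            trunc (k + 1) (oneLine σ) = child (k + 1) A l r B := by
        ext σ
        simp only [Finset.mem_filter, Finset.mem_univ, true_and]
        constructor
        · rintro ⟨-, h⟩
          rw [trunc_succ_eq_child (nodup_oneLine σ) (hmem σ), h]
        · intro h
          have h1 := code_eq_of_trunc_succ_eq_child (nodup_oneLine σ) (hmem σ) hk1 hw.ends.1
            hw.ends.2 h
          refine ⟨?_, h1⟩
          rw [trunc_eq_code (nodup_oneLine σ) (hmem σ), h1]
      rw [hset]
      refine Finset.sum_congr rfl fun σ hσ => ?_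
      rw [← hset, Finset.mem_filter] at hσ
      have hI : Finset.Ioc k n = insert (k + 1) (Finset.Ioc (k + 1) n) := by
        ext; simp only [Finset.mem_Ioc, Finset.mem_insert]; omega
      rw [hI, Finset.prod_insert (by simp), hσ.2]
    · intro σ hσ
      rw [Finset.mem_filter] at hσ
      simp only [Finset.mem_product, List.mem_toFinset, Finset.mem_univ, and_true]
      rw [← hσ.2, trunc_eq_code (nodup_oneLine σ) (hmem σ)]
      exact mem_splits.2 rfl

theorem sum_prod_code_univ {R : Type*} [CommRing R]
    (F : ℕ → List ℕ → Bool → Bool → List ℕ → R) (n : ℕ) (hn : 1 ≤ n) :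
    ∑ σ : Equiv.Perm (Fin n), ∏ j ∈ Finset.Icc 1 n,
        F j (code j (oneLine σ)).1.1 (code j (oneLine σ)).2.1 (code j (oneLine σ)).2.2
          (code j (oneLine σ)).1.2
      = treeSum F n 0 [0] := by
  rw [← sum_prod_code F n n 0 (by omega) [0]
    ⟨by simp, by simp [Collapsed], fun c h1 h2 => by omega⟩]
  rw [Finset.filter_true_of_mem]
  · rfl
  · intro σ _
    refine trunc_of_gt _ _ (fun c hc => ((mem_oneLine σ).1 hc).1) ?_
    intro h
    have := length_oneLine σ
    rw [h] at this
    simp at this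
    omega


/-- Weight of the shape of an inserted letter: peak, double ascent, double descent, valley. -/
def shapeWeight {R : Type*} [CommRing R] (x y : R) : Bool → Bool → R
  | false, false => 1
  | false, true => y
  | true, false => 0
  | true, true => x

/-- Weight of the insertion of a letter in a hole. -/
def stepWeight {R : Type*} [CommRing R] (p q x y : R) (A : List ℕ) (l r : Bool) (B : List ℕ) : R :=
  p ^ B.count 0 * q ^ A.count 0 * shapeWeight x y l r

theorem sum_splits {R : Type*} [CommRing R] (p q : R) (w : List ℕ) :
    ((splits w).map fun s => p ^ s.2.count 0 * q ^ s.1.count 0).sum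
      = bracket p q (w.count 0) := by
  induction w with
  | nil => simp [splits, bracket_zero]
  | cons a w ih =>
    rw [splits, List.map_append, List.sum_append, List.map_map]
    by_cases ha : a = 0
    · subst ha
      simp only [if_true, List.map_cons, List.map_nil, List.sum_cons, List.sum_nil,
        Function.comp_def, List.count_cons_self, List.count_nil, bracket_succ, ← ih,
        ← List.sum_map_mul_left]
      simp only [pow_zero, mul_one, add_zero]
      congr 2
      refine List.map_congr_left fun s _ => ?_
      ring
    · simp only [if_neg ha, List.map_nil, List.sum_nil, zero_add, Function.comp_def,
        List.count_cons_of_ne ha, ih]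

theorem count_child {k : ℕ} (hk : k ≠ 0) (A B : List ℕ) (l r : Bool) :
    (child k A l r B).count 0 = A.count 0 + B.count 0 + l.toNat + r.toNat := by
  have e : ∀ b : Bool, (optHole b).count 0 = b.toNat := by intro b; cases b <;> rfl
  simp only [child, List.count_append, List.count_cons_of_ne hk, e]
  omega

theorem treeSum_stepWeight {R : Type*} [CommRing R] (p q x y : R) (N k : ℕ) (w : List ℕ) :
    treeSum (fun _ => stepWeight p q x y) N k w = motzkinSum p q x y N (w.count 0) := by
  induction N generalizing k w with
  | zero =>
    rw [treeSum, motzkinSum]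
    by_cases h : 0 ∈ w <;> simp [h, List.count_eq_zero]
  | succ N ih =>
    rw [treeSum, motzkinSum, ← sum_splits, ← List.sum_map_mul_right]
    congr 1
    refine List.map_congr_left ?_
    rintro ⟨A, B⟩ hs
    rw [mem_splits] at hs
    have hc : w.count 0 = A.count 0 + B.count 0 + 1 := by
      rw [hs]; simp; omega
    simp only [Fintype.sum_bool, ih, count_child (Nat.succ_ne_zero k), stepWeight, shapeWeight,
      hc, Bool.toNat_true, Bool.toNat_false, Nat.add_sub_cancel, add_zero]
    ring

/-- The letters of a word without its holes. -/
def letters (w : List ℕ) : List ℕ := w.filter (· ≠ 0)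

@[simp] theorem letters_nil : letters [] = [] := rfl

@[simp] theorem letters_zero_cons (w : List ℕ) : letters (0 :: w) = letters w := by
  simp [letters]

theorem letters_cons {a : ℕ} (h : a ≠ 0) (w : List ℕ) : letters (a :: w) = a :: letters w := by
  simp [letters, h]

@[simp] theorem letters_append (u v : List ℕ) : letters (u ++ v) = letters u ++ letters v := by
  simp [letters]

theorem mem_letters {c : ℕ} {w : List ℕ} : c ∈ letters w ↔ c ∈ w ∧ c ≠ 0 := by
  simp [letters]

@[simp] theorem letters_optHole (b : Bool) : letters (optHole b) = [] := by
  cases b <;> rfl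

/-- No double descent in `c :: w`, at a letter of `w`. -/
def NoDD : ℕ → List ℕ → Prop
  | _, [] => True
  | c, d :: w => ¬ (d < c ∧ w.headD 0 < d) ∧ NoDD d w

theorem noDD_iff (c : ℕ) (w : List ℕ) : NoDD c w ↔ ∀ i < w.length,
    ¬ ((c :: w).getD (i + 1) 0 < (c :: w).getD i 0 ∧
      (c :: w).getD (i + 2) 0 < (c :: w).getD (i + 1) 0) := by
  induction w generalizing c with
  | nil => simp [NoDD]
  | cons d w ih =>
    rw [NoDD, ih, List.length_cons, Nat.forall_lt_succ_left]
    refine and_congr ?_ (forall₂_congr fun i _ => ?_)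
    · cases w <;> simp
    · simp

theorem dd_eq_zero_iff (w : List ℕ) : dd w = 0 ↔ NoDD 0 w := by
  rw [noDD_iff, dd, Finset.card_eq_zero, Finset.filter_eq_empty_iff]
  constructor
  · intro h i hi
    exact h (x := i + 1) (by rw [Finset.mem_Icc]; omega)
  · intro h i hi
    rw [Finset.mem_Icc] at hi
    obtain ⟨i, rfl⟩ : ∃ i', i = i' + 1 := ⟨i - 1, by omega⟩
    exact h i (by omega)

/-- Whether a maximal letter can be put in front of `w` without creating a double descent. -/
def live : List ℕ → Bool
  | [] => true
  | b :: w => decide (b ≤ w.headD 0)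

theorem noDD_insert {c k : ℕ} {u v : List ℕ} (hc : c ≤ k) (hu : ∀ d ∈ u, d < k)
    (hv : ∀ d ∈ v, d < k) (h : NoDD c (u ++ v)) : NoDD c (u ++ k :: v) ↔ live v := by
  induction u generalizing c with
  | nil =>
    cases v with
    | nil => simp [NoDD, live]; omega
    | cons b v =>
      have := hv b (by simp)
      simp only [List.nil_append, NoDD, List.headD_cons] at h ⊢
      simp only [live, decide_eq_true_eq]
      have h2 := h.2
      constructor
      · rintro ⟨-, h3, -⟩
        omega
      · intro h3
        exact ⟨by omega, by omega, h2⟩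
  | cons d u ih =>
    simp only [List.cons_append, NoDD] at h ⊢
    have hd := hu d (by simp)
    rw [ih hd.le (fun e he => hu e (by simp [he])) h.2, and_iff_right_iff_imp]
    intro _
    cases u with
    | nil => simp; omega
    | cons e u => simpa using h.1

/-- Every hole that is not live is followed by one letter and a live hole. -/
def Paired : List ℕ → Prop
  | [] => True
  | a :: w => (a = 0 → live (letters w) = false →
      ∃ b B, w = b :: 0 :: B ∧ live (letters B) = true) ∧ Paired w

/-- Number of holes that are not live. -/
def deadCount : List ℕ → ℕ
  | [] => 0
  | a :: w => (if a = 0 ∧ live (letters w) = false then 1 else 0) + deadCount w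

/-- Number (`0` or `1`) of holes of `A` that become live when the hole between `A` and `B`
receives a letter. -/
def partner (B : List ℕ) : List ℕ → ℕ
  | [] => 0
  | a :: A => (if a = 0 ∧ (letters A).length = 1 ∧ live (letters (A ++ 0 :: B)) = false
      then 1 else 0) + partner B A

theorem live_append_cons {K : ℕ} {e : ℕ} {U V : List ℕ} (he : e ≤ K)
    (h : live (e :: U ++ V) = true) : live (e :: U ++ K :: V) = true := by
  cases U with
  | nil => simpa [live] using he
  | cons f U => simpa [live] using h

theorem paired_deadCount_replace {K : ℕ} {X B : List ℕ} (hX : letters X = K :: letters B)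
    (hPX : Paired X) (A : List ℕ) (hA : ∀ c ∈ A, c < K) (hC : Collapsed (A ++ 0 :: B))
    (hP : Paired (A ++ 0 :: B)) :
    Paired (A ++ X) ∧ deadCount (A ++ X) + partner B A + deadCount (0 :: B)
      = deadCount (A ++ 0 :: B) + deadCount X := by
  induction A with
  | nil => exact ⟨hPX, by simp [partner]; omega⟩
  | cons a A ih =>
    obtain ⟨ih1, ih2⟩ := ih (fun c hc => hA c (by simp [hc])) hC.2 hP.2
    generalize deadCount (0 :: B) = d at ih2 ⊢
    by_cases ha : a = 0
    · subst ha
      have hC1 : (A ++ 0 :: B).headD 1 ≠ 0 := hC.1 rfl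
      have hP1 := hP.1 rfl
      simp only [List.append_eq] at hP1
      simp only [List.cons_append, Paired, deadCount, partner, true_and, true_imp_iff]
      rcases A with _ | ⟨b, A⟩
      · simp at hC1
      have hb : b ≠ 0 := by simpa using hC1
      have hbK : b ≤ K := (hA b (by simp)).le
      have e1 : letters (b :: A ++ X) = b :: (letters A ++ K :: letters B) := by
        simp [letters_cons hb, hX]
      have e2 : letters (b :: A ++ 0 :: B) = b :: (letters A ++ letters B) := by
        simp [letters_cons hb]
      have e3 : (letters (b :: A)).length = (letters A).length + 1 := by
        simp [letters_cons hb]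
      rw [e2] at hP1
      rw [e1, e2, e3]
      rcases hL : letters A with _ | ⟨e, L⟩
      · have hlive : live (b :: ([] ++ K :: letters B)) = true := by simp [live, hbK]
        rw [hlive]
        refine ⟨⟨by simp, ih1⟩, ?_⟩
        simp only [List.length_nil, zero_add, true_and, Bool.true_eq_false, if_false]
        omega
      · have heA : e ∈ A := (mem_letters.1 (by rw [hL]; simp : e ∈ letters A)).1
        have heK : e ≤ K := (hA e (by simp [heA])).le
        rw [hL] at hP1
        have hiff : live (b :: (e :: L ++ K :: letters B))
            = live (b :: (e :: L ++ letters B)) := by simp [live]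
        rw [hiff]
        constructor
        · refine ⟨fun hd => ?_, ih1⟩
          obtain ⟨b', B', hB, hB'⟩ := hP1 hd
          rw [List.cons_append, List.cons.injEq] at hB
          obtain ⟨rfl, hB⟩ := hB
          rcases A with _ | ⟨a, A⟩
          · simp at hL
          · rw [List.cons_append, List.cons.injEq] at hB
            obtain ⟨rfl, rfl⟩ := hB
            refine ⟨b, A ++ X, rfl, ?_⟩
            rw [letters_zero_cons] at hL
            rw [letters_append, letters_zero_cons, hL] at hB'
            rw [letters_append, hX, hL]
            exact live_append_cons heK hB'
        · have hlen : ¬ ((e :: L).length + 1 = 1 ∧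
              live (b :: (e :: L ++ letters B)) = false) := by simp
          rw [if_neg hlen]
          omega
    · simp only [List.cons_append, Paired, deadCount, partner, ha, false_and, if_false, zero_add,
        false_imp_iff, true_and]
      exact ⟨ih1, ih2⟩

theorem paired_child {k : ℕ} {A B : List ℕ} {l r : Bool} (hlr : (l, r) ≠ (true, false))
    (hk : ∀ c ∈ A ++ 0 :: B, c < k) (hC : Collapsed (A ++ 0 :: B)) (hP : Paired (A ++ 0 :: B))
    (hB : live (letters B) = true) :
    Paired (child k A l r B) ∧ deadCount (child k A l r B) + partner B A
      = deadCount (A ++ 0 :: B) + (l && r).toNat := by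
  have hk0 : k ≠ 0 := by have := hk 0 (by simp); omega
  have hPB : ∀ A, Paired (A ++ 0 :: B) → Paired B := by
    intro A h
    induction A with
    | nil => exact h.2
    | cons a A ih => exact ih h.2
  have hdead : live (k :: letters B) = false := by
    cases h : letters B with
    | nil => simp [live]; omega
    | cons b L =>
      have hb : b ∈ B := (mem_letters.1 (by rw [h]; simp : b ∈ letters B)).1
      simpa [live] using hk b (by simp [hb])
  have hX : letters (optHole l ++ k :: (optHole r ++ B)) = k :: letters B := by
    simp [letters_cons hk0]
  have hPX : Paired (optHole l ++ k :: (optHole r ++ B)) := by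
    have := hPB A hP
    cases l <;> cases r
    · simp [optHole, Paired, hk0, this]
    · simp [optHole, Paired, hk0, this, hB]
    · exact absurd rfl hlr
    · simp [optHole, Paired, hk0, this, hB]
  have hdX : deadCount (optHole l ++ k :: (optHole r ++ B))
      = deadCount (0 :: B) + (l && r).toNat := by
    cases l <;> cases r
    · simp [optHole, deadCount, hk0, hB]
    · simp [optHole, deadCount, hk0, hB]
    · exact absurd rfl hlr
    · simp [optHole, deadCount, hk0, hB, letters_cons hk0, hdead]
      omega
  obtain ⟨h1, h2⟩ := paired_deadCount_replace hX hPX A (fun c hc => hk c (by simp [hc])) hC hP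
  unfold child
  rw [List.append_assoc]
  exact ⟨h1, by omega⟩

theorem partner_cons_of_ne {a : ℕ} (h : a ≠ 0) (A B : List ℕ) :
    partner B (a :: A) = partner B A := by
  simp [partner, h]

/-- A live hole together with its partner weighs as much as two holes. -/
theorem sum_splits_live {R : Type*} [CommRing R] (q : R) (w : List ℕ) (hC : Collapsed w)
    (hP : Paired w) :
    ((splits w).map fun s => if live (letters s.2) = true then
      (q ^ 2) ^ s.2.count 0 * q ^ s.1.count 0 * (1 + q) ^ partner s.2 s.1 else 0).sum
      = bracket (q ^ 2) q (w.count 0) := by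
  induction w with
  | nil => simp [splits, bracket_zero]
  | cons a w ih =>
    have ih := ih hC.2 hP.2
    rw [splits, List.map_append, List.sum_append, List.map_map]
    by_cases ha : a = 0
    · subst ha
      rw [List.count_cons_self, bracket_succ, ← ih, ← List.sum_map_mul_left]
      simp only [if_true, List.map_cons, List.map_nil, List.sum_cons, List.sum_nil,
        Function.comp_def, List.count_cons_self, List.count_nil, partner, true_and]
      cases hw : live (letters w) with
      | true =>
        simp only [if_true, pow_zero, mul_one, add_zero]
        congr 2
        refine List.map_congr_left ?_
        rintro ⟨A, B⟩ hs
        rw [mem_splits] at hs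
        simp only [← hs, hw, Bool.true_eq_false, and_false, if_false, zero_add]
        split_ifs <;> ring
      | false =>
        obtain ⟨b, B', rfl, hB'⟩ := hP.1 rfl hw
        have hb : b ≠ 0 := by simpa using hC.1 rfl
        have hsplit : splits (b :: 0 :: B')
            = ([b], B') :: (splits B').map fun s => (b :: 0 :: s.1, s.2) := by
          simp [splits, hb]
        have hp : partner B' [b] = 0 := by simp [partner, hb]
        have hl : (letters [b]).length = 1 := by simp [letters_cons hb]
        have hc : (b :: 0 :: B').count 0 = B'.count 0 + 1 := by
          rw [List.count_cons_of_ne hb, List.count_cons_self]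
        have hc' : [b].count 0 = 0 := by rw [List.count_cons_of_ne hb, List.count_nil]
        rw [hsplit]
        simp only [List.map_cons, List.sum_cons, List.map_map, Function.comp_def, hB', if_true,
          hp, hl, hc, hc', List.cons_append, List.nil_append, hw, true_and]
        simp only [Bool.false_eq_true, if_false]
        have key : ((splits B').map fun s => if live (letters s.2) = true then
            (q ^ 2) ^ s.2.count 0 * q ^ ((b :: 0 :: s.1).count 0 + 1) * (1 + q) ^
              ((if (letters (b :: 0 :: s.1)).length = 1 ∧
                live (letters (b :: 0 :: (s.1 ++ 0 :: s.2))) = false then 1 else 0) +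
              partner s.2 (b :: 0 :: s.1)) else 0).sum
            = ((splits B').map fun s => q * if live (letters s.2) = true then
              (q ^ 2) ^ s.2.count 0 * q ^ ((b :: 0 :: s.1).count 0) * (1 + q) ^
              partner s.2 (b :: 0 :: s.1) else 0).sum := by
          congr 1
          refine List.map_congr_left ?_
          rintro ⟨A, B⟩ hs
          rw [mem_splits] at hs
          have hL : (letters A).length ≠ 0 := by
            have h1 : B'.headD 1 ≠ 0 := hC.2.2.1 rfl
            rcases A with _ | ⟨a, A⟩
            · simp [hs] at h1
            · have : a ≠ 0 := by simpa [hs] using h1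
              simp [letters_cons this]
          have hL' : ¬ ((letters (b :: 0 :: A)).length = 1 ∧
              live (letters (b :: 0 :: (A ++ 0 :: B))) = false) := by
            simp only [letters_cons hb, letters_zero_cons, List.length_cons]
            omega
          dsimp only
          rw [if_neg hL', zero_add]
          split_ifs <;> ring
        rw [key]
        ring
    · simp only [if_neg ha, List.map_nil, List.sum_nil, zero_add, Function.comp_def,
        List.count_cons_of_ne ha, partner_cons_of_ne ha, ih]

theorem deadCount_eq_zero {w : List ℕ} (h : 0 ∉ w) : deadCount w = 0 := by
  induction w with
  | nil => rfl
  | cons a w ih =>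
    rw [List.mem_cons, not_or] at h
    rw [deadCount, ih h.2, if_neg (fun h1 => h.1 h1.1.symm)]

theorem letters_child {k : ℕ} (hk : k ≠ 0) (A B : List ℕ) (l r : Bool) :
    letters (child k A l r B) = letters A ++ k :: letters B := by
  simp [child, letters_cons hk]

theorem treeSum_andre {R : Type*} [CommRing R] (q x y : R) (N k : ℕ) (w : List ℕ)
    (hk : ∀ c ∈ w, c ≤ k) (hC : Collapsed w) (hD : NoDD 0 (letters w)) (hP : Paired w) :
    (1 + q) ^ deadCount w * treeSum (fun k A l r B =>
        if dd (letters (child k A l r B)) = 0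
          then stepWeight (q ^ 2) q ((1 + q) * x) y A l r B else 0) N k w
      = motzkinSum (q ^ 2) q x y N (w.count 0) := by
  set F : ℕ → List ℕ → Bool → Bool → List ℕ → R := fun k A l r B =>
    if dd (letters (child k A l r B)) = 0
      then stepWeight (q ^ 2) q ((1 + q) * x) y A l r B else 0
  have hF : ∀ k A l r B, F k A l r B = if dd (letters (child k A l r B)) = 0
      then stepWeight (q ^ 2) q ((1 + q) * x) y A l r B else 0 := fun _ _ _ _ _ => rfl
  induction N generalizing k w with
  | zero =>
    rw [treeSum, motzkinSum]
    by_cases h : 0 ∈ w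
    · simp [h, List.count_eq_zero]
    · simp [h, List.count_eq_zero, deadCount_eq_zero h]
  | succ N ih =>
    rw [treeSum, motzkinSum, ← sum_splits_live q w hC hP, ← List.sum_map_mul_right,
      ← List.sum_map_mul_left]
    congr 1
    refine List.map_congr_left ?_
    rintro ⟨A, B⟩ hs
    rw [mem_splits] at hs
    have hc : w.count 0 = A.count 0 + B.count 0 + 1 := by
      rw [hs]; simp; omega
    have hkw : ∀ c ∈ A ++ 0 :: B, c < k + 1 := fun c hc => by
      have := hk c (hs ▸ hc); omega
    have hDAB : NoDD 0 (letters A ++ letters B) := by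
      rw [hs] at hD; simpa using hD
    have hiff : NoDD 0 (letters A ++ (k + 1) :: letters B) ↔ live (letters B) :=
      noDD_insert (by omega) (fun d hd => hkw d (by simp [(mem_letters.1 hd).1]))
        (fun d hd => hkw d (by simp [(mem_letters.1 hd).1])) hDAB
    have hdd : ∀ l r, dd (letters (child (k + 1) A l r B)) = 0 ↔ live (letters B) = true := by
      intro l r
      rw [dd_eq_zero_iff, letters_child (by omega), hiff]
    simp only [hF, hdd]
    by_cases hB : live (letters B) = true
    · simp only [hB, if_true]
      have hstep : ∀ l r, (l, r) ≠ (true, false) →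
          (1 + q) ^ (deadCount w + (l && r).toNat) * treeSum F N (k + 1)
              (child (k + 1) A l r B)
            = (1 + q) ^ partner B A * motzkinSum (q ^ 2) q x y N
              (A.count 0 + B.count 0 + l.toNat + r.toNat) := by
        intro l r hlr
        have hs' := hs
        subst hs'
        obtain ⟨h1, h2⟩ := paired_child (k := k + 1) hlr hkw hC hP hB
        rw [← count_child (Nat.succ_ne_zero k), ← ih (k + 1) _ ?_
          (collapsed_child l r hC (by omega)) ?_ h1, ← h2]
        · ring
        · intro c hc
          simp only [child, List.mem_append, List.mem_cons] at hc hkw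
          rcases hc with (hc | hc) | hc | hc | hc
          · have := hkw c (Or.inl hc); omega
          · cases l <;> simp [optHole] at hc; omega
          · omega
          · cases r <;> simp [optHole] at hc; omega
          · have := hkw c (Or.inr (Or.inr hc)); omega
        · rw [letters_child (by omega), hiff, hB]
      have h1 := hstep false false (by simp)
      have h2 := hstep false true (by simp)
      have h3 := hstep true true (by simp)
      simp only [Bool.toNat_true, Bool.toNat_false, Bool.and_self, Bool.false_and, add_zero]
        at h1 h2 h3
      rw [pow_succ (1 + q)] at h3
      simp only [Fintype.sum_bool, stepWeight, shapeWeight, hc, Nat.add_sub_cancel]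
      linear_combination (q ^ 2) ^ B.count 0 * q ^ A.count 0 * (h1 + y * h2 + x * h3)
    · simp [hB]


/-- Number of adjacent pairs `c d` of letters with `c > j > d`. -/
def downCross (j : ℕ) : List ℕ → ℕ
  | [] => 0
  | c :: w => (if j < c ∧ w.headD j < j then 1 else 0) + downCross j w

/-- Number of adjacent pairs `c d` of letters with `c < j < d`. -/
def upCross (j : ℕ) : List ℕ → ℕ
  | [] => 0
  | c :: w => (if c < j ∧ j < w.headD j then 1 else 0) + upCross j w

theorem headD_trunc {j : ℕ} {w : List ℕ} :
    (trunc j w).headD 1 = 0 ↔ w ≠ [] ∧ (w.headD 1 = 0 ∨ j < w.headD 1) := by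
  cases w with
  | nil => simp [trunc]
  | cons c w =>
    simp only [trunc]
    split_ifs with h
    · simp; omega
    · rw [consHole_eq]; simp; omega

theorem trunc_ne_nil {j : ℕ} {w : List ℕ} (h : w ≠ []) : trunc j w ≠ [] := by
  cases w with
  | nil => exact absurd rfl h
  | cons c w =>
    simp only [trunc]
    split_ifs
    · simp
    · rw [consHole_eq]; simp

theorem getLastD_consHole {w : List ℕ} (h : w ≠ []) :
    (consHole w).getLastD 1 = w.getLastD 1 := by
  unfold consHole
  split_ifs
  · rfl
  · exact getLastD_cons_of_ne_nil h

theorem getLastD_trunc {j : ℕ} {w : List ℕ} (hw : ∀ c ∈ w, 1 ≤ c) :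
    (trunc j w).getLastD 1 = 0 ↔ j < w.getLastD 0 := by
  induction w with
  | nil => simp [trunc]
  | cons c w ih =>
    have hc := hw c (by simp)
    by_cases h : w = []
    · subst h
      simp only [trunc]
      split_ifs with h1
      · simp; omega
      · simp [consHole]; omega
    · rw [getLastD_cons_of_ne_nil h, ← ih fun d hd => hw d (by simp [hd])]
      simp only [trunc]
      split_ifs
      · rw [getLastD_cons_of_ne_nil (trunc_ne_nil h)]
      · rw [getLastD_consHole (trunc_ne_nil h)]

theorem headD_trunc_of_pos {j : ℕ} {w : List ℕ} (hw : ∀ c ∈ w, 1 ≤ c) :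
    (trunc j w).headD 1 = 0 ↔ j < w.headD 0 := by
  rw [headD_trunc]
  cases w with
  | nil => simp
  | cons c w =>
    have := hw c (by simp)
    simp; omega

theorem count_dropLastHole_trunc {j : ℕ} {w : List ℕ} (hw : ∀ c ∈ w, 1 ≤ c ∧ c ≠ j) :
    (dropLastHole (trunc j w)).count 0 = downCross j w := by
  induction w with
  | nil => rfl
  | cons c w ih =>
    have hc := hw c (by simp)
    have ih := ih fun d hd => hw d (by simp [hd])
    by_cases h : w = []
    · subst h
      simp only [trunc, downCross, List.headD_nil, lt_irrefl, and_false, if_false, add_zero]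
      split_ifs with h1
      · simp [dropLastHole, show c ≠ 0 by omega]
      · simp [consHole, dropLastHole]
    · have hT := trunc_ne_nil (j := j) h
      have hhead := headD_trunc (j := j) (w := w)
      obtain ⟨d, w, rfl⟩ := List.exists_cons_of_ne_nil h
      have hd := hw d (by simp)
      rw [downCross, ← ih, trunc]
      split_ifs with h1 h2 h2
      · omega
      · rw [dropLastHole, if_neg hT, List.count_cons_of_ne (by omega)]; omega
      · simp only [List.headD_cons] at h2 hhead
        unfold consHole
        rw [if_neg (by rw [hhead]; simp; omega), dropLastHole, if_neg hT,
          List.count_cons_self]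
        omega
      · simp only [List.headD_cons] at h2 hhead
        unfold consHole
        rw [if_pos (by rw [hhead]; simp; omega)]
        omega

theorem count_dropHeadHole_add (w : List ℕ) :
    w.count 0 = (dropHeadHole w).count 0 + if w.headD 1 = 0 then 1 else 0 := by
  cases w with
  | nil => rfl
  | cons a w => by_cases ha : a = 0 <;> simp [dropHeadHole, ha]

theorem count_dropHeadHole_trunc {j : ℕ} {w : List ℕ} (hw : ∀ c ∈ w, 1 ≤ c ∧ c ≠ j) :
    (dropHeadHole (trunc j w)).count 0 = upCross j w := by
  induction w with
  | nil => rfl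
  | cons c w ih =>
    have hc := hw c (by simp)
    have ih := ih fun d hd => hw d (by simp [hd])
    rw [upCross, ← ih, trunc]
    have hcount := count_dropHeadHole_add (trunc j w)
    rw [if_congr headD_trunc rfl rfl] at hcount
    split_ifs with h1 h2 h2
    · rw [dropHeadHole, if_neg (by simp; omega), List.count_cons_of_ne (by omega), hcount, if_pos]
      · omega
      · rcases w with _ | ⟨d, w⟩
        · simp at h2
        · simpa using Or.inr h2.2
    · rw [dropHeadHole, if_neg (by simp; omega), List.count_cons_of_ne (by omega), hcount, if_neg]
      · omega
      · rcases w with _ | ⟨d, w⟩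
        · simp
        · have := hw d (by simp)
          simp only [List.headD_cons] at h2
          simp; omega
    · omega
    · rw [consHole_eq, dropHeadHole, if_pos (by simp), List.tail_cons, zero_add]

theorem downCross_eq_card (j : ℕ) (w : List ℕ) : downCross j w
    = ((Finset.range w.length).filter fun s => j < w.getD s 0 ∧ w.getD (s + 1) j < j).card := by
  induction w with
  | nil => rfl
  | cons c w ih =>
    rw [downCross, ih, Finset.card_filter, Finset.card_filter, List.length_cons,
      Finset.sum_range_succ', add_comm]
    congr 1
    cases w <;> simp

theorem upCross_eq_card (j : ℕ) (w : List ℕ) : upCross j w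
    = ((Finset.range w.length).filter fun s => w.getD s 0 < j ∧ j < w.getD (s + 1) j).card := by
  induction w with
  | nil => rfl
  | cons c w ih =>
    rw [upCross, ih, Finset.card_filter, Finset.card_filter, List.length_cons,
      Finset.sum_range_succ', add_comm]
    congr 1
    cases w <;> simp

theorem letter_succ (w : List ℕ) (i : ℕ) : letter w (i + 1) = w.getD i 0 := rfl

theorem letter_of_lt {w : List ℕ} {i : ℕ} (h : w.length < i) : letter w i = 0 := by
  obtain ⟨i, rfl⟩ : ∃ i', i = i' + 1 := ⟨i - 1, by omega⟩
  rw [letter_succ, List.getD_eq_default _ _ (by omega)]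

theorem getLastD_take (w : List ℕ) (i : ℕ) (h : i ≤ w.length) :
    (w.take i).getLastD 0 = letter w i := by
  cases i with
  | zero => simp [letter]
  | succ i =>
    rw [letter_succ, List.getLastD_eq_getLast?, List.getLast?_take, if_neg (by omega)]
    simp [List.getElem?_eq_getElem (show i < w.length by omega)]

theorem headD_drop (w : List ℕ) (i : ℕ) : (w.drop i).headD 0 = letter w (i + 1) := by
  rw [letter_succ]
  simp [List.head?_drop]

@[to_additive]
theorem prod_Icc_eq_prod_range {R : Type*} [CommMonoid R] (n : ℕ) (f : ℕ → R) :
    ∏ i ∈ Finset.Icc 1 n, f i = ∏ i ∈ Finset.range n, f (i + 1) := by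
  rw [Finset.prod_bij' (i := fun i _ => i - 1) (j := fun i _ => i + 1)] <;>
    simp only [Finset.mem_Icc, Finset.mem_range] <;> intros <;> first | omega | (congr 1; omega)

theorem les_eq_sum (w : List ℕ) :
    les w = ∑ i ∈ Finset.range w.length, downCross (letter w (i + 1)) (w.take i) := by
  have h1 : les w = ∑ y ∈ Finset.Icc 1 w.length, ((Finset.Icc 2 w.length).filter fun x =>
      x < y ∧ letter w y < letter w (x - 1) ∧ letter w x < letter w y).card := by
    unfold les
    rw [Finset.card_filter, Finset.sum_product_right]
    simp only [Finset.card_filter]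
    refine Finset.sum_subset (Finset.Icc_subset_Icc (by omega) le_rfl) fun y hy hy' => ?_
    refine Finset.sum_eq_zero fun x hx => if_neg ?_
    rw [Finset.mem_Icc] at hx hy hy'
    omega
  rw [h1, sum_Icc_eq_sum_range]
  refine Finset.sum_congr rfl fun i hi => ?_
  rw [Finset.mem_range] at hi
  rw [downCross_eq_card, List.length_take, min_eq_left hi.le]
  have hget : ∀ s d, (w.take i).getD s d = if s < i then w.getD s d else d := by
    intro s d
    simp only [List.getD_eq_getElem?_getD, List.getElem?_take]
    split_ifs <;> rfl
  have hd : ∀ s, s < i → ∀ d, w.getD s d = letter w (s + 1) := by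
    intro s hs d
    rw [letter_succ, List.getD_eq_getElem _ _ (by omega), List.getD_eq_getElem _ _ (by omega)]
  refine Finset.card_nbij' (fun x => x - 2) (fun s => s + 2) ?_ ?_ ?_ ?_
  · intro x hx
    simp only [Finset.coe_filter, Finset.mem_Icc, Finset.mem_range, Set.mem_ofPred_eq] at hx ⊢
    obtain ⟨x, rfl⟩ : ∃ x', x = x' + 2 := ⟨x - 2, by omega⟩
    rw [Nat.add_sub_cancel, hget, hget, if_pos (by omega), if_pos (by omega), hd _ (by omega),
      hd _ (by omega)]
    exact ⟨by omega, hx.2.2⟩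
  · intro s hs
    simp only [Finset.coe_filter, Finset.mem_Icc, Finset.mem_range, Set.mem_ofPred_eq] at hs ⊢
    rw [hget, hget, if_pos (by omega)] at hs
    split_ifs at hs
    · rw [hd _ (by omega), hd _ (by omega)] at hs
      exact ⟨by omega, by omega, hs.2⟩
    · omega
  · intro x hx
    simp only [Finset.coe_filter, Finset.mem_Icc, Set.mem_ofPred_eq] at hx
    dsimp only
    omega
  · intro s hs
    simp

theorem res_eq_sum (w : List ℕ) :
    res w = ∑ i ∈ Finset.range w.length, upCross (letter w (i + 1)) (w.drop (i + 1)) := by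
  have h1 : res w = ∑ x ∈ Finset.Icc 1 w.length, ((Finset.Icc 1 (w.length - 1)).filter fun y =>
      x < y ∧ letter w x < letter w (y + 1) ∧ letter w y < letter w x).card := by
    unfold res
    rw [Finset.card_filter, Finset.sum_product]
    simp only [Finset.card_filter]
    refine Finset.sum_subset (Finset.Icc_subset_Icc le_rfl (by omega)) fun y hy hy' => ?_
    refine Finset.sum_eq_zero fun x hx => if_neg ?_
    rw [Finset.mem_Icc] at hx hy hy'
    omega
  rw [h1, sum_Icc_eq_sum_range]
  refine Finset.sum_congr rfl fun i hi => ?_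
  rw [Finset.mem_range] at hi
  rw [upCross_eq_card, List.length_drop]
  have hget : ∀ s d, i + 1 + s < w.length →
      (w.drop (i + 1)).getD s d = letter w (i + s + 2) := by
    intro s d hs
    rw [show i + s + 2 = (i + 1 + s) + 1 by omega, letter_succ, List.getD_eq_getElem?_getD,
      List.getElem?_drop, List.getElem?_eq_getElem hs, List.getD_eq_getElem _ _ hs]
    rfl
  refine Finset.card_nbij' (fun x => x - (i + 2)) (fun s => i + s + 2) ?_ ?_ ?_ ?_
  · intro y hy
    simp only [Finset.coe_filter, Finset.mem_Icc, Finset.mem_range, Set.mem_ofPred_eq] at hy ⊢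
    obtain ⟨s, rfl⟩ : ∃ s, y = i + s + 2 := ⟨y - (i + 2), by omega⟩
    rw [show i + s + 2 - (i + 2) = s by omega, hget _ _ (by omega), hget _ _ (by omega)]
    exact ⟨by omega, hy.2.2.2, hy.2.2.1⟩
  · intro s hs
    simp only [Finset.coe_filter, Finset.mem_Icc, Finset.mem_range, Set.mem_ofPred_eq] at hs ⊢
    by_cases h : i + 1 + (s + 1) < w.length
    · rw [hget _ _ (by omega), hget _ _ h] at hs
      exact ⟨by omega, by omega, hs.2.2, hs.2.1⟩
    · rw [List.getD_eq_default _ (letter w (i + 1)) (by rw [List.length_drop]; omega)] at hs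
      omega
  · intro x hx
    simp only [Finset.coe_filter, Finset.mem_Icc, Set.mem_ofPred_eq] at hx
    dsimp only
    omega
  · intro s hs
    dsimp only
    omega

/-- A word with `n` distinct positive letters. -/
structure IsWord (w : List ℕ) : Prop where
  nodup : w.Nodup
  pos : ∀ c ∈ w, 1 ≤ c

theorem IsWord.letter_pos {w : List ℕ} (h : IsWord w) {i : ℕ} (hi : i < w.length) :
    1 ≤ letter w (i + 1) := by
  rw [letter_succ, List.getD_eq_getElem _ _ hi]
  exact h.pos _ (List.getElem_mem hi)

theorem IsWord.split {w : List ℕ} (h : IsWord w) {i : ℕ} (hi : i < w.length) :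
    before (letter w (i + 1)) w = w.take i ∧ after (letter w (i + 1)) w = w.drop (i + 1) ∧
      (∀ c ∈ w.take i, 1 ≤ c ∧ c ≠ letter w (i + 1)) ∧
      (∀ c ∈ w.drop (i + 1), 1 ≤ c ∧ c ≠ letter w (i + 1)) := by
  have hs : w = w.take i ++ letter w (i + 1) :: w.drop (i + 1) := by
    rw [letter_succ, List.getD_eq_getElem _ _ hi]
    simp
  have hnd := h.nodup
  rw [hs, List.nodup_middle, List.nodup_cons, List.mem_append, not_or] at hnd
  refine ⟨?_, ?_, ?_, ?_⟩
  · have := before_eq (b := w.drop (i + 1)) hnd.1.1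
    rwa [← hs] at this
  · have := after_eq (b := w.drop (i + 1)) hnd.1.1
    rwa [← hs] at this
  · exact fun c hc => ⟨h.pos c (List.mem_of_mem_take hc), fun h0 => hnd.1.1 (h0 ▸ hc)⟩
  · exact fun c hc => ⟨h.pos c (List.mem_of_mem_drop hc), fun h0 => hnd.1.2 (h0 ▸ hc)⟩

/-- Whether the letter with index `i + 1` is smaller than its left neighbour. -/
def leftDown (w : List ℕ) (i : ℕ) : Bool := decide (letter w (i + 1) < letter w i)

/-- Whether the letter with index `i + 1` is smaller than its right neighbour. -/
def rightUp (w : List ℕ) (i : ℕ) : Bool := decide (letter w (i + 1) < letter w (i + 2))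

theorem IsWord.stepWeight_code {R : Type*} [CommRing R] (p q x y : R) {w : List ℕ} (h : IsWord w)
    {i : ℕ} (hi : i < w.length) {j : ℕ} (hj : letter w (i + 1) = j) :
    stepWeight p q x y (code j w).1.1 (code j w).2.1 (code j w).2.2 (code j w).1.2
      = p ^ upCross j (w.drop (i + 1)) * q ^ downCross j (w.take i)
        * shapeWeight x y (leftDown w i) (rightUp w i) := by
  subst hj
  obtain ⟨h1, h2, h3, h4⟩ := h.split hi
  simp only [stepWeight, code, h1, h2, count_dropLastHole_trunc h3, count_dropHeadHole_trunc h4,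
    getLastD_trunc fun c hc => (h3 c hc).1, headD_trunc_of_pos fun c hc => (h4 c hc).1,
    getLastD_take w i hi.le, headD_drop]
  rfl

theorem valley_eq_card (w : List ℕ) : valley w
    = ((Finset.range w.length).filter fun i => leftDown w i ∧ rightUp w i).card := by
  rw [valley, Finset.card_filter, Finset.card_filter, sum_Icc_eq_sum_range]
  simp [leftDown, rightUp]

theorem IsWord.rightUp_iff {w : List ℕ} (h : IsWord w) {i : ℕ} (hi : i + 1 < w.length) :
    rightUp w i = !leftDown w (i + 1) := by
  have hne : letter w (i + 1) ≠ letter w (i + 2) := by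
    rw [letter_succ, letter_succ, List.getD_eq_getElem _ _ hi,
      List.getD_eq_getElem _ _ (by omega)]
    intro h0
    have := (List.Nodup.getElem_inj_iff h.nodup).1 h0
    omega
  change decide _ = !decide (letter w (i + 2) < letter w (i + 1))
  simp only [← decide_not, decide_eq_decide]
  omega

theorem rightUp_last {w : List ℕ} {i : ℕ} (hi : w.length ≤ i + 1) : rightUp w i = false := by
  simp [rightUp, letter_of_lt (show w.length < i + 2 by omega)]

theorem leftDown_zero (w : List ℕ) : leftDown w 0 = false := by
  simp [leftDown, letter]

theorem IsWord.dd_eq_card {w : List ℕ} (h : IsWord w) : dd w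
    = ((Finset.range w.length).filter fun i => leftDown w i ∧ ¬ rightUp w i).card := by
  rw [dd, Finset.card_filter, Finset.card_filter, sum_Icc_eq_sum_range]
  refine Finset.sum_congr rfl fun i hi => ?_
  rw [Finset.mem_range] at hi
  congr 1
  rw [Nat.add_sub_cancel]
  by_cases hi' : i + 1 < w.length
  · rw [h.rightUp_iff hi']
    simp [leftDown]
  · rw [rightUp_last (by omega), letter_of_lt (show w.length < i + 1 + 1 by omega)]
    have := h.letter_pos hi
    simp [leftDown]
    omega

theorem des_eq_card (w : List ℕ) : des w
    = ((Finset.range w.length).filter fun i => leftDown w i).card := by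
  rw [des, Finset.card_filter, Finset.card_filter, sum_Icc_eq_sum_range]
  rcases hn : w.length with _ | n
  · rfl
  · rw [Finset.sum_range_succ, Finset.sum_range_succ', leftDown_zero, if_neg (by omega),
      if_neg (by simp)]
    congr 1
    refine Finset.sum_congr rfl fun i hi => ?_
    rw [Finset.mem_range] at hi
    simp [leftDown, hi]

theorem IsWord.des_eq {w : List ℕ} (h : IsWord w) : des w = valley w + dd w := by
  rw [des_eq_card, valley_eq_card, h.dd_eq_card, Finset.card_filter, Finset.card_filter,
    Finset.card_filter, ← Finset.sum_add_distrib]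
  refine Finset.sum_congr rfl fun i _ => ?_
  cases leftDown w i <;> cases rightUp w i <;> rfl

theorem IsWord.card_rightUp {w : List ℕ} (h : IsWord w) :
    ((Finset.range w.length).filter fun i => rightUp w i).card + des w = w.length - 1 := by
  rw [des_eq_card, Finset.card_filter, Finset.card_filter]
  rcases hn : w.length with _ | n
  · rfl
  · rw [Finset.sum_range_succ, Finset.sum_range_succ', leftDown_zero, rightUp_last (by omega)]
    simp only [Bool.false_eq_true, if_false, add_zero, Nat.add_sub_cancel]
    rw [← Finset.sum_add_distrib, Finset.sum_congr rfl (g := fun _ => 1)]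
    · simp
    · intro i hi
      rw [Finset.mem_range] at hi
      rw [h.rightUp_iff (by omega)]
      cases leftDown w (i + 1) <;> rfl

/-- The double ascents are those letters which are neither peaks nor valleys. -/
theorem IsWord.card_ascent {w : List ℕ} (h : IsWord w) (hdd : dd w = 0) :
    ((Finset.range w.length).filter fun i => ¬ leftDown w i ∧ rightUp w i).card + 2 * valley w
      = w.length - 1 := by
  have h1 := h.card_rightUp
  have h2 := h.des_eq
  have h3 : ((Finset.range w.length).filter fun i => rightUp w i).card = valley w +
      ((Finset.range w.length).filter fun i => ¬ leftDown w i ∧ rightUp w i).card := by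
    rw [valley_eq_card, Finset.card_filter, Finset.card_filter, Finset.card_filter,
      ← Finset.sum_add_distrib]
    refine Finset.sum_congr rfl fun i _ => ?_
    cases leftDown w i <;> cases rightUp w i <;> rfl
  omega

theorem IsWord.prod_shapeWeight {R : Type*} [CommRing R] (x y : R) {w : List ℕ} (h : IsWord w) :
    ∏ i ∈ Finset.range w.length, shapeWeight x y (leftDown w i) (rightUp w i)
      = if dd w = 0 then x ^ valley w * y ^ (w.length - 1 - 2 * valley w) else 0 := by
  split_ifs with hdd
  · rw [← h.card_ascent hdd, Nat.add_sub_cancel, valley_eq_card, ← Finset.prod_const,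
      ← Finset.prod_const, Finset.prod_filter, Finset.prod_filter, ← Finset.prod_mul_distrib]
    refine Finset.prod_congr rfl fun i hi => ?_
    rw [h.dd_eq_card, Finset.card_eq_zero, Finset.filter_eq_empty_iff] at hdd
    have := hdd hi
    cases h1 : leftDown w i <;> cases h2 : rightUp w i <;> simp_all [shapeWeight]
  · rw [h.dd_eq_card, ← Ne, Finset.card_ne_zero] at hdd
    obtain ⟨i, hi⟩ := hdd
    rw [Finset.mem_filter] at hi
    refine Finset.prod_eq_zero hi.1 ?_
    rw [hi.2.1, Bool.eq_false_iff.2 hi.2.2]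
    rfl

theorem isWord_oneLine {n : ℕ} (σ : Equiv.Perm (Fin n)) : IsWord (oneLine σ) :=
  ⟨nodup_oneLine σ, fun _ hc => ((mem_oneLine σ).1 hc).1⟩

theorem letter_oneLine {n : ℕ} (σ : Equiv.Perm (Fin n)) (i : Fin n) :
    letter (oneLine σ) (i + 1) = σ i + 1 := by
  rw [letter_succ, List.getD_eq_getElem _ _ (by simp [length_oneLine])]
  simp [oneLine]

theorem prod_oneLine {R : Type*} [CommRing R] {n : ℕ} (σ : Equiv.Perm (Fin n)) (f : ℕ → R) :
    ∏ j ∈ Finset.Icc 1 n, f j = ∏ i ∈ Finset.range n, f (letter (oneLine σ) (i + 1)) := by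
  rw [← Fin.prod_univ_eq_prod_range (fun i => f (letter (oneLine σ) (i + 1)))]
  simp only [letter_oneLine]
  rw [Equiv.prod_comp σ fun i : Fin n => f (i + 1),
    Fin.prod_univ_eq_prod_range (fun i => f (i + 1)), prod_Icc_eq_prod_range]

theorem prod_stepWeight_code {R : Type*} [CommRing R] (p q x y : R) {n : ℕ}
    (σ : Equiv.Perm (Fin n)) :
    ∏ j ∈ Finset.Icc 1 n, stepWeight p q x y (code j (oneLine σ)).1.1 (code j (oneLine σ)).2.1
        (code j (oneLine σ)).2.2 (code j (oneLine σ)).1.2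
      = if dd (oneLine σ) = 0 then p ^ res (oneLine σ) * q ^ les (oneLine σ) *
          (x ^ valley (oneLine σ) * y ^ (n - 1 - 2 * valley (oneLine σ))) else 0 := by
  have hw := isWord_oneLine σ
  have hl := length_oneLine σ
  rw [prod_oneLine σ]
  have h1 : ∏ i ∈ Finset.range (oneLine σ).length, _ = ∏ i ∈ Finset.range (oneLine σ).length, _ :=
    Finset.prod_congr rfl fun i hi =>
      hw.stepWeight_code p q x y (Finset.mem_range.1 hi) rfl
  rw [hl] at h1
  rw [h1, Finset.prod_mul_distrib, Finset.prod_mul_distrib, Finset.prod_pow_eq_pow_sum,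
    Finset.prod_pow_eq_pow_sum]
  have h2 := hw.prod_shapeWeight x y
  have h3 := les_eq_sum (oneLine σ)
  have h4 := res_eq_sum (oneLine σ)
  rw [hl] at h2 h3 h4
  rw [h2, ← h3, ← h4]
  split_ifs <;> simp

theorem letters_trunc (j : ℕ) {w : List ℕ} (hw : ∀ c ∈ w, 1 ≤ c) :
    letters (trunc j w) = subword w j := by
  induction w with
  | nil => rfl
  | cons c w ih =>
    have ih := ih fun d hd => hw d (by simp [hd])
    have hc := hw c (by simp)
    rw [trunc, subword]
    split_ifs with h
    · rw [letters_cons (by omega), ih, List.filter_cons_of_pos (by simp; omega)]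
      rfl
    · rw [List.filter_cons_of_neg (by simp; omega)]
      unfold consHole
      split_ifs
      · exact ih
      · rw [letters_zero_cons]; exact ih

theorem prod_andre_code {R : Type*} [CommRing R] (p q x y : R) {n : ℕ}
    (σ : Equiv.Perm (Fin n)) :
    ∏ j ∈ Finset.Icc 1 n, (if dd (letters (child j (code j (oneLine σ)).1.1
        (code j (oneLine σ)).2.1 (code j (oneLine σ)).2.2 (code j (oneLine σ)).1.2)) = 0
        then stepWeight p q x y (code j (oneLine σ)).1.1 (code j (oneLine σ)).2.1
        (code j (oneLine σ)).2.2 (code j (oneLine σ)).1.2 else 0)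
      = if IsAndre σ ∧ dd (oneLine σ) = 0 then p ^ res (oneLine σ) * q ^ les (oneLine σ) *
          (x ^ valley (oneLine σ) * y ^ (n - 1 - 2 * valley (oneLine σ))) else 0 := by
  rw [Finset.prod_ite_zero, prod_stepWeight_code, ite_and]
  refine if_congr (forall₂_congr fun j hj => ?_) rfl rfl
  rw [Finset.mem_Icc] at hj
  obtain ⟨k, rfl⟩ : ∃ k, j = k + 1 := ⟨j - 1, by omega⟩
  rw [← trunc_succ_eq_child (nodup_oneLine σ) ((mem_oneLine σ).2 hj),
    letters_trunc _ (isWord_oneLine σ).pos]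

theorem IsAndre.dd_eq_zero {n : ℕ} {σ : Equiv.Perm (Fin n)} (h : IsAndre σ) :
    dd (oneLine σ) = 0 := by
  rcases n with _ | n
  · simp [dd, length_oneLine]
  · have h1 := h (n + 1) (by simp)
    have h2 : subword (oneLine σ) (n + 1) = oneLine σ := by
      refine List.filter_eq_self.2 fun c hc => ?_
      simpa using ((mem_oneLine σ).1 hc).2
    rwa [h2] at h1

theorem two_mul_valley_le {n : ℕ} {σ : Equiv.Perm (Fin n)} (h : dd (oneLine σ) = 0) :
    2 * valley (oneLine σ) ≤ n - 1 := by
  have := (isWord_oneLine σ).card_ascent h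
  rw [length_oneLine] at this
  omega

theorem sum_gammaPoly {R : Type*} [CommRing R] (p q x y : R) (n : ℕ) (hn : 1 ≤ n) :
    ∑ k ∈ Finset.range ((n - 1) / 2 + 1), gammaPoly n k p q * x ^ k * y ^ (n - 1 - 2 * k)
      = motzkinSum p q x y n 1 := by
  have h1 := sum_prod_code_univ (fun _ => stepWeight p q x y) n hn
  rw [treeSum_stepWeight] at h1
  simp only [prod_stepWeight_code] at h1
  rw [← Finset.sum_filter] at h1
  simp only [List.count_cons_self, List.count_nil, zero_add] at h1
  rw [← h1, ← Finset.sum_fiberwise_of_maps_to (t := Finset.range ((n - 1) / 2 + 1))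
    (g := fun σ => valley (oneLine σ))]
  · refine Finset.sum_congr rfl fun k _ => ?_
    rw [gammaPoly, Finset.sum_mul, Finset.sum_mul, permG, Finset.filter_filter]
    refine Finset.sum_congr (by ext; simp [and_comm]) fun σ hσ => ?_
    rw [Finset.mem_filter] at hσ
    rw [hσ.2.2]
    ring
  · intro σ hσ
    have := two_mul_valley_le (Finset.mem_filter.1 hσ).2
    rw [Finset.mem_range]
    omega

theorem sum_dPoly {R : Type*} [CommRing R] (q x y : R) (n : ℕ) (hn : 1 ≤ n) :
    ∑ k ∈ Finset.range ((n - 1) / 2 + 1),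
        (1 + q) ^ k * dPoly n k q * x ^ k * y ^ (n - 1 - 2 * k)
      = motzkinSum (q ^ 2) q x y n 1 := by
  have h0 := treeSum_andre q x y n 0 [0] (by simp) (by simp [Collapsed]) (by simp [NoDD])
    (by simp [Paired, live])
  rw [show deadCount [0] = 0 by simp [deadCount, live], pow_zero, one_mul,
    ← sum_prod_code_univ _ n hn] at h0
  simp only [prod_andre_code] at h0
  rw [← Finset.sum_filter] at h0
  simp only [List.count_cons_self, List.count_nil, zero_add] at h0
  rw [← h0, ← Finset.sum_fiberwise_of_maps_to (t := Finset.range ((n - 1) / 2 + 1))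
    (g := fun σ => valley (oneLine σ))]
  · refine Finset.sum_congr rfl fun k _ => ?_
    rw [dPoly, Finset.mul_sum, Finset.sum_mul, Finset.sum_mul, permD, Finset.filter_filter]
    have hset : (Finset.univ.filter fun σ : Equiv.Perm (Fin n) =>
        IsAndre σ ∧ des (oneLine σ) = k) = Finset.univ.filter fun σ : Equiv.Perm (Fin n) =>
        (IsAndre σ ∧ dd (oneLine σ) = 0) ∧ valley (oneLine σ) = k := by
      ext σ
      simp only [Finset.mem_filter, Finset.mem_univ, true_and]
      have := (isWord_oneLine σ).des_eq
      constructor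
      · rintro ⟨h1, h2⟩
        have := h1.dd_eq_zero
        exact ⟨⟨h1, this⟩, by omega⟩
      · rintro ⟨⟨h1, h2⟩, h3⟩
        exact ⟨h1, by omega⟩
    rw [hset]
    refine Finset.sum_congr rfl fun σ hσ => ?_
    rw [Finset.mem_filter] at hσ
    rw [hσ.2.2, mul_pow]
    ring
  · intro σ hσ
    have := two_mul_valley_le (Finset.mem_filter.1 hσ).2.2
    rw [Finset.mem_range]
    omega

theorem exc_oneLine {n : ℕ} (σ : Equiv.Perm (Fin n)) : exc (oneLine σ) = permExc σ := by
  rw [exc, permExc, length_oneLine, Finset.card_filter, sum_Icc_eq_sum_range,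
    ← Fin.sum_univ_eq_sum_range (fun i => if i + 1 < letter (oneLine σ) (i + 1) then 1 else 0)]
  simp [letter_oneLine]

theorem inv_oneLine {n : ℕ} (σ : Equiv.Perm (Fin n)) : inv (oneLine σ) = permInv σ := by
  rw [inv, permInv, length_oneLine, Finset.card_filter, Finset.sum_product, sum_Icc_eq_sum_range]
  simp only [sum_Icc_eq_sum_range]
  rw [← Fin.sum_univ_eq_sum_range (fun i => ∑ j ∈ Finset.range n, if i + 1 < j + 1 ∧
    letter (oneLine σ) (j + 1) < letter (oneLine σ) (i + 1) then 1 else 0)]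
  refine Finset.sum_congr rfl fun i _ => ?_
  rw [← Fin.sum_univ_eq_sum_range (fun j => if i.val + 1 < j + 1 ∧
    letter (oneLine σ) (j + 1) < letter (oneLine σ) (i.val + 1) then 1 else 0)]
  simp [letter_oneLine]

end AndrePerm

theorem mainTheorem4 {R : Type*} [CommRing R] (q t : R) (n : ℕ) (hn : 1 ≤ n) :
    (∀ σ : Equiv.Perm (Fin n),
      AndrePerm.exc (AndrePerm.oneLine σ) ≤ AndrePerm.inv (AndrePerm.oneLine σ)) ∧
    (∑ σ : Equiv.Perm (Fin n),
        q ^ (AndrePerm.inv (AndrePerm.oneLine σ) - AndrePerm.exc (AndrePerm.oneLine σ)) *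
          t ^ AndrePerm.exc (AndrePerm.oneLine σ)
      = ∑ k ∈ Finset.range ((n - 1) / 2 + 1),
          AndrePerm.gammaPoly n k (q ^ 2) q * t ^ k * (1 + t) ^ (n - 1 - 2 * k)) ∧
    (∑ k ∈ Finset.range ((n - 1) / 2 + 1),
          AndrePerm.gammaPoly n k (q ^ 2) q * t ^ k * (1 + t) ^ (n - 1 - 2 * k)
      = ∑ k ∈ Finset.range ((n - 1) / 2 + 1),
          (1 + q) ^ k * AndrePerm.dPoly n k q * t ^ k * (1 + t) ^ (n - 1 - 2 * k)) := by
  simp only [AndrePerm.exc_oneLine, AndrePerm.inv_oneLine]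
  refine ⟨AndrePerm.permExc_le_permInv, ?_, ?_⟩
  · rw [AndrePerm.sum_gammaPoly _ _ _ _ n hn]
    exact AndrePerm.sum_permWeight q t n hn
  · rw [AndrePerm.sum_gammaPoly _ _ _ _ n hn, AndrePerm.sum_dPoly _ _ _ n hn]
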